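/- **Setting.** Let $n\ge 2$, queries $q_1,\dots,q_m\in\mathbb R^d$, keys $k_1,\dots,k_n\in\mathbb R^d$, values $V\in\mathbb R^{n\times d}$, scale $\beta>0$. The exact softmax attention is $O\in\mathbb R^{m\times d}$ with $O_{ij}=\sum_l e^{\beta\langle q_i,k_l\rangle}V_{lj}\big/\sum_l e^{\beta\langle q_i,k_l\rangle}$. Put $\bar k=\frac1n\sum_l k_l$, $\tilde k_l=k_l-\bar k$, $R_Q=\max_i\|q_i\|_2$, $R_K=\max_l\|\tilde k_l\|_2$, and assume $R_Q,R_K>0$. $\|\cdot\|_{\max}$ is the largest absolute entry, $W_0$ the principal branch of the Lambert function, $\rho_0=\sqrt{1+e^{W_0(2/e^2)+2}}$, and $\mathrm{Ent}(p)=-p\log p-(1-p)\log(1-p)$. **RPNys.** Given a kernel $h$, points $x_1,\dots,x_N$ and a rank $r$, start with $p_l=h(x_l,x_l)$, $M=0\in\mathbb R^{r\times r}$, $R=0\in\mathbb R^{r\times N}$ and an empty coreset. In round $i=1,\dots,r$ draw $s$ with probability $p_s/\sum_l p_l$ (if $p=0$, do nothing more) and add it to the coreset; let $g\in\mathbb R^r$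 have the entries $g_{[i-1]}=M_{[i-1],[i-1]}R_{[i-1],s}/\sqrt{p_s}$, $g_i=-1/\sqrt{p_s}$ and $0$ elsewhere; replace $M$ by $M+gg^\top$ and the $i$-th row of $R$ by $(h(x_s,x_l))_l$; replace $p_l$ by $p_l-\big(\sum_{j\le i}g_jR_{jl}\big)^2$ for all $l$, and then set $p_s=0$. The output is the coreset and the weights $W=MR$. **WildCat with rank $r$ and $B\ge1$ bins.** Let $n_{\rm eff}=\lfloor n/B\rfloor$ and $r_{\rm eff}=\lceil r/B\rceil$, and assume $n_{\rm eff}\ge2$. Divide the indices $1,\dots,n$ into $B$ bins, each of size $\lfloor n/B\rfloor$ or $\lceil n/B\rceil$. Independently on every bin, with $R_K^b$ the largest norm of a recentred key in the bin, run RPNys with rank $r_{\rm eff}$ on the recentred keys of the bin, with the kernel $h_\tau(x,y)=e^{\beta\langle x,y\rangle/\tau^2}$, where $$\tau=\sqrt{\frac{R^b_K}{R_Q}\,\frac{b_0}{2W_0(b_0/(2\rho_0))}},\qquad b_0=\frac{\log n_{\rm eff}}{\beta R_QR^b_K}+2$$ (if $R_K^b=0$ then $h_\tau=1$ on the bin,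 whatever $\tau$ is). Concatenate the coresets to $S$ and the weights to a block matrix $W$ (the weights of a bin act on the keys of that bin only), and put $V_S=WV$, $w=W\mathbf 1_n$. With $\widehat A_{ic}=e^{\beta\langle q_i,k_c\rangle}$ for $c\in S$, the output $\widehat O$ has the entries $(\widehat AV_S)_{ij}/(\widehat Aw)_i$ if $(\widehat Aw)_i>0$ and $0$ otherwise, clipped to $[\min_lV_{lj},\max_lV_{lj}]$. **Theorem.** Fix $a\ge\frac12$. Take first $B=1$, so that $(n_{\rm eff},r_{\rm eff})=(n,r)$, and let $$\gamma=\frac{\beta R_QR_K}{\log n},\qquad\delta=\frac{d}{\log n},\qquad\sigma=\frac{a+\gamma}{W_0\!\left(\frac1{2\rho_0\gamma}+\frac1{\rho_0}\right)}.$$ If $$r\ \ge\ 1+\frac1{\sqrt\pi}\,n^{(\sigma+\delta)\mathrm{Ent}\left(\frac{\sigma}{\sigma+\delta}\right)}\log\!\big(n^{2a+\sigma+3\gamma}\big),$$ then $\mathbb E\,\|O-\widehat O\|_{\max}\le 3\,\|V\|_{\max}\,n^{-a}$. For $B>1$ the same holds with $(n_{\rm eff},r_{\rm eff})$ in place of $(n,r)$: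 if $\gamma,\delta,\sigma$ are formed with $n_{\rm eff}$ (and the same $R_Q,R_K$) and the displayed condition holds for $r_{\rm eff}$ and $n_{\rm eff}$, then $\mathbb E\,\|O-\widehat O\|_{\max}\le 3\,\|V\|_{\max}\,n_{\rm eff}^{-a}$. -/

import Mathlib

open scoped ENNReal

noncomputable section

namespace WildCat

/-! ### The Lambert function and the constant `ρ₀` -/

/-- On `(-1, ∞)` the map `w ↦ w * exp w` takes every value `z > -1/e` exactly once. -/
theorem existsUnique_mul_exp {z : ℝ} (hz : -Real.exp (-1) < z) :
    ∃! w : ℝ, -1 < w ∧ w * Real.exp w = z := by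
  have hmono : StrictMonoOn (fun w : ℝ => w * Real.exp w) (Set.Ici (-1)) := by
    apply strictMonoOn_of_deriv_pos (convex_Ici _) (by fun_prop)
    intro x hx
    rw [interior_Ici, Set.mem_Ioi] at hx
    have h : HasDerivAt (fun w : ℝ => w * Real.exp w) (1 * Real.exp x + x * Real.exp x) x :=
      (hasDerivAt_id x).mul (Real.hasDerivAt_exp x)
    rw [h.deriv]
    have := Real.exp_pos x
    nlinarith
  have hle : (-1 : ℝ) ≤ |z| := by linarith [abs_nonneg z]
  have hmem : z ∈ Set.Icc ((fun w : ℝ => w * Real.exp w) (-1))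
      ((fun w : ℝ => w * Real.exp w) |z|) := by
    constructor
    · simp only; linarith
    · simp only
      have h1 := Real.one_le_exp (abs_nonneg z)
      nlinarith [le_abs_self z, abs_nonneg z]
  have hcont : ContinuousOn (fun w : ℝ => w * Real.exp w) (Set.Icc (-1) |z|) := by fun_prop
  obtain ⟨w, hw, hwz⟩ := intermediate_value_Icc hle hcont hmem
  have hw1 : (-1 : ℝ) < w := by
    rcases hw.1.lt_or_eq with h | h
    · exact h
    · subst h; simp only at hwz; linarith
  refine ⟨w, ⟨hw1, hwz⟩, ?_⟩
  rintro y ⟨hy1, hyz⟩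
  exact hmono.injOn (Set.mem_Ici.2 hy1.le) (Set.mem_Ici.2 hw1.le) (hyz.trans hwz.symm)

open Classical in
/-- Principal branch of the Lambert function: for `z > -1/e`, the unique `w > -1` with
`w * exp w = z` (and the irrelevant value `0` for other `z`). -/
def lambertW (z : ℝ) : ℝ :=
  if h : -Real.exp (-1) < z then (existsUnique_mul_exp h).choose else 0

/-- `ρ₀ = √(1 + exp (W₀(2/e²) + 2)) ≈ 3.19`. -/
def rhoZero : ℝ :=
  √(1 + Real.exp (lambertW (2 / Real.exp 1 ^ 2) + 2))

/-! ### Norms and exact attention -/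

/-- Euclidean row space `ℝ^d`; queries and keys are tuples of rows. -/
abbrev Row (d : ℕ) := EuclideanSpace ℝ (Fin d)

/-- Largest absolute entry of a matrix. -/
def maxNorm {m d : ℕ} (X : Matrix (Fin m) (Fin d) ℝ) : ℝ :=
  ⨆ i, ⨆ j, |X i j|

/-- Largest Euclidean norm of a row, `‖X‖_{2,∞}`. -/
def rowNorm {ι : Type} {d : ℕ} (X : ι → Row d) : ℝ :=
  ⨆ i, ‖X i‖

/-- The mean of the rows. -/
def rowMean {n d : ℕ} (K : Fin n → Row d) : Row d :=
  (n : ℝ)⁻¹ • ∑ l, K l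

/-- The recentred rows `k_l - k̄`. -/
def recenter {n d : ℕ} (K : Fin n → Row d) : Fin n → Row d :=
  fun l => K l - rowMean K

/-- Exact softmax attention `D⁻¹ A V` with `A i l = exp (β ⟪q_i, k_l⟫)`, `D = diag (A 1)`. -/
def softmaxAttention {m n d : ℕ} (β : ℝ) (Q : Fin m → Row d) (K : Fin n → Row d)
    (V : Matrix (Fin n) (Fin d) ℝ) : Matrix (Fin m) (Fin d) ℝ :=
  Matrix.of fun i j =>
    (∑ l, Real.exp (β * inner ℝ (Q i) (K l)) * V l j) /
      ∑ l, Real.exp (β * inner ℝ (Q i) (K l))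

/-! ### Randomly pivoted Nyström (`RPNys`) -/

/-- Working memory of `RPNys` with rank parameter `r`: the pivots chosen so far (slot `i` is
filled in round `i`), the matrices `M` and `R`, and the residual kernel diagonal `p`. -/
structure RPNysState (ι : Type) (r : ℕ) where
  pivot : Fin r → Option ι
  M : Matrix (Fin r) (Fin r) ℝ
  R : Matrix (Fin r) ι ℝ
  p : ι → ℝ

section RPNys

variable {ι : Type} {d r : ℕ}

/-- Initial state: empty coreset, `M = 0`, `R = 0`, `p` the kernel diagonal. -/
def rpnysInit (h : Row d → Row d → ℝ) (K : ι → Row d) : RPNysState ι r where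
  pivot := fun _ => none
  M := 0
  R := 0
  p := fun l => h (K l) (K l)

/-- The vector `g` of round `i` with pivot `s`: its entries before `i` are those of
`M_{[i-1],[i-1]} R_{[i-1],s}`, its `i`-th entry is `-1`, all divided by `√p_s`. -/
def rpnysG (st : RPNysState ι r) (i : Fin r) (s : ι) : Fin r → ℝ :=
  fun j =>
    if j < i then (∑ k ∈ Finset.Iio i, st.M j k * st.R k s) / √(st.p s)
    else if j = i then -1 / √(st.p s)
    else 0

open Classical in
/-- Round `i` of `RPNys` once the pivot `s` has been drawn. -/
def rpnysUpdate (h : Row d → Row d → ℝ) (K : ι → Row d) (st : RPNysState ι r) (i : Fin r)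
    (s : ι) : RPNysState ι r :=
  let g := rpnysG st i s
  let R' : Matrix (Fin r) ι ℝ := st.R.updateRow i fun l => h (K s) (K l)
  { pivot := Function.update st.pivot i (some s)
    M := st.M + Matrix.vecMulVec g g
    R := R'
    p := Function.update (fun l => st.p l - (∑ j ∈ Finset.Iic i, g j * R' j l) ^ 2) s 0 }

variable [Fintype ι]

open Classical in
/-- Round `i` of `RPNys`: draw a pivot with probabilities `p / ∑ l, p l` and update. If the
residual diagonal vanishes (the kernel matrix is already reproduced exactly and there is
nothing to sample from), nothing is done. -/
def rpnysRound (h : Row d → Row d → ℝ) (K : ι → Row d) (i : Fin r) (st : RPNysState ι r) :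
    PMF (RPNysState ι r) :=
  if hp : ∑' l, ENNReal.ofReal (st.p l) = 0 then PMF.pure st
  else (PMF.normalize (fun l => ENNReal.ofReal (st.p l)) hp
    (by rw [tsum_fintype]; exact ENNReal.sum_ne_top.2 fun _ _ => ENNReal.ofReal_ne_top)).map
      (rpnysUpdate h K st i)

/-- Law of the state after the first `t` rounds (at most `r` rounds are made). -/
def rpnysRun (h : Row d → Row d → ℝ) (K : ι → Row d) (r : ℕ) : ℕ → PMF (RPNysState ι r)
  | 0 => PMF.pure (rpnysInit h K)
  | t + 1 => (rpnysRun h K r t).bind fun st =>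
      if ht : t < r then rpnysRound h K ⟨t, ht⟩ st else PMF.pure st

/-- Output of `RPNys`: the coreset `K_S` (slots left empty hold the row `0`; the weights there
are `0`) and the Nyström weights `W = M R`. -/
def rpnys (h : Row d → Row d → ℝ) (K : ι → Row d) (r : ℕ) :
    PMF ((Fin r → Row d) × Matrix (Fin r) ι ℝ) :=
  (rpnysRun h K r r).map fun st => (fun j => (st.pivot j).elim 0 K, st.M * st.R)

end RPNys

/-! ### `CompressKV`, `WtdAttn` and `WildCat` -/

/-- The rescaling parameter
`τ = √((R_K / R_Q) * b₀ / (2 W₀(b₀ / (2 ρ₀))))`, `b₀ = log N / (β R_Q R_K) + 2`. -/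
def temperature (β RQ RK : ℝ) (N : ℕ) : ℝ :=
  let b₀ := Real.log N / (β * RQ * RK) + 2
  √(RK / RQ * (b₀ / (2 * lambertW (b₀ / (2 * rhoZero)))))

/-- Law of a tuple of independent random elements with laws `μ 0, …, μ (B - 1)`. -/
def independent : {B : ℕ} → {Ω : Fin B → Type} → (∀ b, PMF (Ω b)) → PMF (∀ b, Ω b)
  | 0, _, _ => PMF.pure fun b => b.elim0
  | _ + 1, _, μ => (μ 0).bind fun x =>
      (independent fun b => μ b.succ).map fun y => Fin.cons x y

/-- `bin` divides `n` rows evenly into `B` bins: all bins have `⌊n/B⌋` or `⌈n/B⌉` rows. -/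
def IsEvenBinning {n B : ℕ} (bin : Fin n → Fin B) : Prop :=
  ∀ b, n / B ≤ Nat.card {l // bin l = b} ∧ Nat.card {l // bin l = b} ≤ ⌈(n : ℝ) / B⌉₊

/-- Output of `CompressKV`: the coreset keys, the compressed values and the normalisation
weights, indexed by bin and by slot within the bin. -/
structure Compressed (B r d : ℕ) where
  keys : Fin B × Fin r → Row d
  values : Matrix (Fin B × Fin r) (Fin d) ℝ
  weights : Fin B × Fin r → ℝ

/-- The rows of the recentred key matrix that lie in bin `b`. -/
def binKeys {n d B : ℕ} (bin : Fin n → Fin B) (K : Fin n → Row d) (b : Fin B) :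
    {l // bin l = b} → Row d :=
  fun l => recenter K l.1

/-- The law of the output of `RPNys` on bin `b`, with kernel `exp (β ⟪·, ·⟫ / τ²)`, the
temperature `τ` of that bin, and rank `⌈r/B⌉`. The length that enters the temperature is the
effective length `⌊n/B⌋` of a bin. (If all rows of the bin are `0`, the kernel is the constant
`1` on them whatever `τ` is.) -/
def binLaw {n d B : ℕ} (β RQ : ℝ) (r : ℕ) (bin : Fin n → Fin B) (K : Fin n → Row d)
    (b : Fin B) :
    PMF ((Fin ⌈(r : ℝ) / B⌉₊ → Row d) × Matrix (Fin ⌈(r : ℝ) / B⌉₊) {l // bin l = b} ℝ) :=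
  let τ := temperature β RQ (rowNorm (binKeys bin K b)) (n / B)
  rpnys (fun x y => Real.exp (β * inner ℝ x y / τ ^ 2)) (binKeys bin K b) ⌈(r : ℝ) / B⌉₊

/-- `CompressKV` on keys `K` and values `V`, with query radius `RQ`, scale `β`, rank `r` and
the division `bin` into `B` bins: the bins are treated independently, and the weights of a bin
occupy the columns of that bin. -/
def compressKV {n d B : ℕ} (K : Fin n → Row d) (V : Matrix (Fin n) (Fin d) ℝ) (RQ β : ℝ)
    (r : ℕ) (bin : Fin n → Fin B) : PMF (Compressed B ⌈(r : ℝ) / B⌉₊ d) :=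
  (independent (binLaw β RQ r bin K)).map fun out =>
    let W : Matrix (Fin B × Fin ⌈(r : ℝ) / B⌉₊) (Fin n) ℝ :=
      Matrix.of fun c l => if hl : bin l = c.1 then (out c.1).2 c.2 ⟨l, hl⟩ else 0
    { keys := fun c => (out c.1).1 c.2 + rowMean K
      values := W * V
      weights := fun c => ∑ l, W c l }

/-- `WtdAttn`: weighted attention with the compressed keys and values, set to `0` where the
normaliser is not positive, and clipped entrywise to `[vmin_j, vmax_j]`. -/
def wtdAttn {m d B r : ℕ} (Q : Fin m → Row d) (C : Compressed B r d) (vmin vmax : Fin d → ℝ)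
    (β : ℝ) : Matrix (Fin m) (Fin d) ℝ :=
  let A : Matrix (Fin m) (Fin B × Fin r) ℝ :=
    Matrix.of fun i c => Real.exp (β * inner ℝ (Q i) (C.keys c))
  Matrix.of fun i j =>
    max (vmin j) (min (vmax j)
      (if 0 < A.mulVec C.weights i then (A * C.values) i j / A.mulVec C.weights i else 0))

/-- The law of the output of `WildCat`. -/
def wildCat {m n d B : ℕ} (Q : Fin m → Row d) (K : Fin n → Row d)
    (V : Matrix (Fin n) (Fin d) ℝ) (β : ℝ) (r : ℕ) (bin : Fin n → Fin B) :
    PMF (Matrix (Fin m) (Fin d) ℝ) :=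
  (compressKV K V (rowNorm Q) β r bin).map fun C =>
    wtdAttn Q C (fun j => ⨅ l, V l j) (fun j => ⨆ l, V l j) β

/-- Expectation of a nonnegative random variable with discrete law. -/
def expectation {Ω : Type} (μ : PMF Ω) (f : Ω → ℝ≥0∞) : ℝ≥0∞ :=
  ∑' ω, μ ω * f ω

end WildCat

end

noncomputable section

namespace WildCat

/-! ### Expectations -/

section Expectation

variable {Ω Ω' : Type}

/-! Let Φ be the Fock-space feature map, with ⟨Φ(x), Φ(y)⟩ = e^{⟨x,y⟩} (`inner_expFeature`). On a
bin of positive radius the kernel of `RPNys` is the Gram kernel of the vectors Φ(θk̃_l), θ = √β/τ,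
while e^{β⟨q,k̃⟩} = ⟨Φ(μq), Φ(θk̃)⟩ with μ = √β τ. The rounds of `RPNys` are Gram–Schmidt steps: the
weighted coreset is the orthogonal projection of each Φ(θk̃_l) onto the span of the coreset, and p_l
is the squared norm of the residual (`RPNysInvariant`).

Deterministic part (`maxNorm_softmaxAttention_sub_le`): by Cauchy–Schwarz the attention weight of
key l is wrong by at most e^{β⟨q,k̄⟩} e^{μ²R_Q²/2} times its residual norm. By Jensen the softmax
denominator is at least n e^{β⟨q,k̄⟩}, and clipping turns a relative ℓ¹ error of the weights into an
error of the output.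

Random part (`expectation_coresetError_le`): split the coefficient space ℝ^N of a bin with N keys
into the span of the monomials of degree at most s in the keys, of dimension k ≤ C(s+d, s), and its
orthogonal complement. The residual energy in the complement never increases and starts below the
Taylor tail of exp beyond degree s, hence below η. The energy X in the span drops on average by at
least X²/(k(X+η)) per round, so it becomes comparable with η after about k log(1/η) rounds, up to
normalisation. With s = ⌊(α+g)/W⌋, where α = a log n_eff and g = βR_QR_K^b, the tail is small
enough, and Stirling with Gibbs' inequality bounds k by the entropy power in the rank condition
(`exists_expectation_binLaw_le`). The inequality of the arithmetic and geometric means joins the two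
parts (`expectation_wildCat_le`). -/

theorem expectation_pure (x : Ω) (f : Ω → ℝ≥0∞) : expectation (PMF.pure x) f = f x := by
  classical
  unfold expectation
  rw [tsum_eq_single x]
  · simp
  · intro y hy
    simp [PMF.pure_apply, hy]

theorem expectation_bind (μ : PMF Ω) (κ : Ω → PMF Ω') (f : Ω' → ℝ≥0∞) :
    expectation (μ.bind κ) f = expectation μ fun ω => expectation (κ ω) f := by
  unfold expectation
  simp_rw [PMF.bind_apply, ← ENNReal.tsum_mul_right, ← ENNReal.tsum_mul_left]
  rw [ENNReal.tsum_comm]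
  simp_rw [mul_assoc]

theorem expectation_map (μ : PMF Ω) (g : Ω → Ω') (f : Ω' → ℝ≥0∞) :
    expectation (μ.map g) f = expectation μ fun ω => f (g ω) := by
  rw [PMF.map, expectation_bind]
  simp [expectation_pure]

theorem expectation_mono_of_support {μ : PMF Ω} {f g : Ω → ℝ≥0∞}
    (h : ∀ ω ∈ μ.support, f ω ≤ g ω) : expectation μ f ≤ expectation μ g := by
  refine ENNReal.tsum_le_tsum fun ω => ?_
  by_cases hω : ω ∈ μ.support
  · exact mul_le_mul_right (h ω hω) _
  · rw [PMF.mem_support_iff, not_not] at hω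
    simp [hω]

theorem expectation_mono {μ : PMF Ω} {f g : Ω → ℝ≥0∞} (h : ∀ ω, f ω ≤ g ω) :
    expectation μ f ≤ expectation μ g :=
  expectation_mono_of_support fun ω _ => h ω

theorem expectation_const (μ : PMF Ω) (c : ℝ≥0∞) : expectation μ (fun _ => c) = c := by
  unfold expectation
  rw [ENNReal.tsum_mul_right, μ.tsum_coe, one_mul]

theorem expectation_add (μ : PMF Ω) (f g : Ω → ℝ≥0∞) :
    expectation μ (fun ω => f ω + g ω) = expectation μ f + expectation μ g := by
  unfold expectation
  simp_rw [mul_add]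
  exact ENNReal.tsum_add

theorem expectation_const_mul (μ : PMF Ω) (c : ℝ≥0∞) (f : Ω → ℝ≥0∞) :
    expectation μ (fun ω => c * f ω) = c * expectation μ f := by
  unfold expectation
  rw [← ENNReal.tsum_mul_left]
  exact tsum_congr fun ω => by ring

theorem expectation_independent_sum {B : ℕ} {Ω : Fin B → Type} (μ : ∀ b, PMF (Ω b))
    (f : ∀ b, Ω b → ℝ≥0∞) :
    expectation (independent μ) (fun ω => ∑ b, f b (ω b)) = ∑ b, expectation (μ b) (f b) := by
  induction B with
  | zero => simp [expectation_const]
  | succ B ih =>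
    rw [independent, expectation_bind]
    simp_rw [expectation_map, Fin.sum_univ_succ, Fin.cons_zero, Fin.cons_succ, expectation_add,
      expectation_const]
    rw [ih]

end Expectation

/-! ### Correctness of `RPNys` -/

section Invariant

open scoped InnerProductSpace

variable {ι : Type} {d r : ℕ} {F : Type} [NormedAddCommGroup F] [InnerProductSpace ℝ F]

/-- The feature vector of slot `j` of the coreset, `0` if the slot is empty. -/
def slotFeature (φ : ι → F) (st : RPNysState ι r) (j : Fin r) : F :=
  (st.pivot j).elim 0 φ

/-- The part of the feature vector of `l` that is not reproduced by the weighted coreset. -/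
def residual (φ : ι → F) (st : RPNysState ι r) (l : ι) : F :=
  φ l - ∑ j, (st.M * st.R) j l • slotFeature φ st j

/-- The state of `RPNys` after `t` rounds: the residuals are orthogonal to the coreset, and `p`
holds their squared norms. -/
structure RPNysInvariant (φ : ι → F) (t : ℕ) (st : RPNysState ι r) : Prop where
  pivot_none : ∀ j : Fin r, t ≤ j → st.pivot j = none
  M_row : ∀ j, st.pivot j = none → ∀ k, st.M j k = 0
  M_col : ∀ k, st.pivot k = none → ∀ j, st.M j k = 0
  R_eq : ∀ j l, st.R j l = ⟪slotFeature φ st j, φ l⟫_ℝ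
  orth : ∀ l j, ⟪residual φ st l, slotFeature φ st j⟫_ℝ = 0
  p_eq : ∀ l, st.p l = ‖residual φ st l‖ ^ 2

theorem residual_init (φ : ι → F) (h : Row d → Row d → ℝ) (K : ι → Row d) (l : ι) :
    residual φ (rpnysInit h K : RPNysState ι r) l = φ l := by
  simp [residual, rpnysInit, slotFeature]

theorem rpnysInvariant_init {φ : ι → F} {h : Row d → Row d → ℝ} {K : ι → Row d}
    (hφ : ∀ l l', h (K l) (K l') = ⟪φ l, φ l'⟫_ℝ) :
    RPNysInvariant φ 0 (rpnysInit h K : RPNysState ι r) where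
  pivot_none := fun _ _ => rfl
  M_row := fun _ _ _ => rfl
  M_col := fun _ _ _ => rfl
  R_eq := fun j l => by simp [rpnysInit, slotFeature]
  orth := fun l j => by simp [rpnysInit, slotFeature]
  p_eq := fun l => by
    rw [residual_init, ← real_inner_self_eq_norm_sq, ← hφ]
    rfl

/-- φ l' and its residual differ by a combination of coreset features, to which every residual is
orthogonal. -/
theorem RPNysInvariant.inner_residual {φ : ι → F} {t : ℕ} {st : RPNysState ι r}
    (hst : RPNysInvariant φ t st) (l l' : ι) :
    ⟪residual φ st l, φ l'⟫_ℝ = ⟪residual φ st l, residual φ st l'⟫_ℝ := by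
  have : φ l' = residual φ st l' + ∑ j, (st.M * st.R) j l' • slotFeature φ st j := by
    rw [residual]; abel
  conv_lhs => rw [this]
  rw [inner_add_right, inner_sum]
  simp [inner_smul_right, hst.orth]

theorem RPNysInvariant.mono {φ : ι → F} {t t' : ℕ} {st : RPNysState ι r}
    (hst : RPNysInvariant φ t st) (h : t ≤ t') : RPNysInvariant φ t' st :=
  { hst with pivot_none := fun j hj => hst.pivot_none j (h.trans hj) }

omit [InnerProductSpace ℝ F] in
theorem slotFeature_update (φ : ι → F) (h : Row d → Row d → ℝ) (K : ι → Row d)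
    (st : RPNysState ι r) (i : Fin r) (s : ι) (j : Fin r) :
    slotFeature φ (rpnysUpdate h K st i s) j = if j = i then φ s else slotFeature φ st j := by
  classical
  by_cases hj : j = i
  · subst hj; simp [slotFeature, rpnysUpdate]
  · simp [slotFeature, rpnysUpdate, hj]

section Update

variable {φ : ι → F} {h : Row d → Row d → ℝ} {K : ι → Row d} {st : RPNysState ι r} {i : Fin r}

/-- The sum over earlier slots in `rpnysG` may run over all slots, since rows and columns of `M`
vanish at empty slots. -/
theorem RPNysInvariant.rpnysG_eq (hst : RPNysInvariant φ i st) (s : ι) (j : Fin r) :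
    rpnysG st i s j = (if j = i then -1 else (st.M * st.R) j s) / √(st.p s) := by
  unfold rpnysG
  rcases lt_trichotomy j i with hj | hj | hj
  · rw [if_pos hj, if_neg hj.ne, Matrix.mul_apply]
    congr 1
    refine Finset.sum_subset (Finset.subset_univ _) fun k _ hk => ?_
    rw [Finset.mem_Iio, not_lt] at hk
    rw [hst.M_col k (hst.pivot_none k hk), zero_mul]
  · simp [hj]
  · rw [if_neg hj.not_gt, if_neg hj.ne', if_neg hj.ne', Matrix.mul_apply]
    simp [hst.M_row j (hst.pivot_none j hj.le)]

/-- So `g` holds the coordinates of minus the normalised pivot residual, and adding `g gᵀ` to `M`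
extends the projection by that unit vector. -/
theorem RPNysInvariant.sum_rpnysG_smul (hst : RPNysInvariant φ i st) (s : ι) :
    ∑ j, rpnysG st i s j • (if j = i then φ s else slotFeature φ st j) =
      -((√(st.p s))⁻¹ • residual φ st s) := by
  have hi : slotFeature φ st i = 0 := by
    simp [slotFeature, hst.pivot_none i le_rfl]
  have : ∀ j, rpnysG st i s j • (if j = i then φ s else slotFeature φ st j) =
      (√(st.p s))⁻¹ • ((st.M * st.R) j s • slotFeature φ st j - if j = i then φ s else 0) := by
    intro j
    rw [hst.rpnysG_eq]
    by_cases hj : j = i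
    · subst hj
      simp [hi, div_eq_inv_mul]
    · simp [hj, div_eq_inv_mul, mul_smul]
  simp_rw [this, ← Finset.smul_sum, Finset.sum_sub_distrib]
  rw [← smul_neg, residual]
  simp

theorem RPNysInvariant.R_update (hst : RPNysInvariant φ i st)
    (hφ : ∀ l l', h (K l) (K l') = ⟪φ l, φ l'⟫_ℝ) (s : ι) (j : Fin r) (l : ι) :
    (rpnysUpdate h K st i s).R j l = ⟪if j = i then φ s else slotFeature φ st j, φ l⟫_ℝ := by
  by_cases hj : j = i
  · subst hj; simp [rpnysUpdate, hφ]
  · simp [rpnysUpdate, hj, hst.R_eq]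

theorem RPNysInvariant.sum_rpnysG_mul (hst : RPNysInvariant φ i st)
    (hφ : ∀ l l', h (K l) (K l') = ⟪φ l, φ l'⟫_ℝ) (s l : ι) :
    ∑ j, rpnysG st i s j * (rpnysUpdate h K st i s).R j l =
      -((√(st.p s))⁻¹ * ⟪residual φ st s, residual φ st l⟫_ℝ) := by
  simp_rw [hst.R_update hφ, ← real_inner_smul_left, ← sum_inner]
  rw [hst.sum_rpnysG_smul, inner_neg_left, real_inner_smul_left, hst.inner_residual,
    real_inner_smul_left]

/-- The Gram–Schmidt step. A pivot with `st.p s = 0` has residual zero, so the identity survives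
division by zero. -/
theorem RPNysInvariant.residual_update (hst : RPNysInvariant φ i st)
    (hφ : ∀ l l', h (K l) (K l') = ⟪φ l, φ l'⟫_ℝ) (s l : ι) :
    residual φ (rpnysUpdate h K st i s) l = residual φ st l -
      (⟪residual φ st s, residual φ st l⟫_ℝ / st.p s) • residual φ st s := by
  have hp : 0 ≤ st.p s := by rw [hst.p_eq]; positivity
  have hMR : ∀ j, ((rpnysUpdate h K st i s).M * (rpnysUpdate h K st i s).R) j l =
      (st.M * st.R) j l + rpnysG st i s j *
        ∑ k, rpnysG st i s k * (rpnysUpdate h K st i s).R k l := by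
    intro j
    have h1 : (rpnysUpdate h K st i s).M = st.M + Matrix.vecMulVec (rpnysG st i s)
        (rpnysG st i s) := rfl
    rw [h1, Matrix.add_mul, Matrix.add_apply]
    congr 1
    · simp_rw [Matrix.mul_apply]
      refine Finset.sum_congr rfl fun k _ => ?_
      by_cases hk : k = i
      · subst hk; rw [hst.M_col k (hst.pivot_none k le_rfl), zero_mul, zero_mul]
      · simp [rpnysUpdate, hk]
    · simp_rw [Matrix.mul_apply, Matrix.vecMulVec_apply, Finset.mul_sum, mul_assoc]
  have hi : slotFeature φ st i = 0 := by
    simp [slotFeature, hst.pivot_none i le_rfl]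
  have hMi : ∀ l, (st.M * st.R) i l = 0 := fun l => by
    simp [Matrix.mul_apply, hst.M_row i (hst.pivot_none i le_rfl)]
  have h2 : ∑ j, (st.M * st.R) j l • (if j = i then φ s else slotFeature φ st j) =
      ∑ j, (st.M * st.R) j l • slotFeature φ st j := by
    refine Finset.sum_congr rfl fun j _ => ?_
    by_cases hj : j = i
    · subst hj; simp [hMi]
    · simp [hj]
  rw [residual]
  simp_rw [hMR, slotFeature_update, add_smul, Finset.sum_add_distrib, hst.sum_rpnysG_mul hφ]
  rw [h2]
  simp_rw [mul_comm (rpnysG _ _ _ _), mul_smul _ (rpnysG _ _ _ _)]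
  rw [← Finset.smul_sum, hst.sum_rpnysG_smul, smul_neg, neg_smul, neg_neg, smul_smul, ← sub_sub,
    ← residual]
  congr 2
  rw [mul_right_comm, ← mul_inv, Real.mul_self_sqrt hp, inv_mul_eq_div]

theorem RPNysInvariant.update (hst : RPNysInvariant φ i st)
    (hφ : ∀ l l', h (K l) (K l') = ⟪φ l, φ l'⟫_ℝ) {s : ι} (hs : 0 < st.p s) :
    RPNysInvariant φ (i + 1) (rpnysUpdate h K st i s) := by
  classical
  have hpiv : ∀ j, (rpnysUpdate h K st i s).pivot j =
      if j = i then some s else st.pivot j := by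
    intro j
    simp [rpnysUpdate, Function.update_apply]
  have hnone : ∀ j, (rpnysUpdate h K st i s).pivot j = none →
      st.pivot j = none ∧ rpnysG st i s j = 0 := by
    intro j hj
    rw [hpiv] at hj
    split_ifs at hj with hji
    refine ⟨hj, ?_⟩
    rw [hst.rpnysG_eq, if_neg hji, Matrix.mul_apply]
    simp [hst.M_row j hj]
  have hres := hst.residual_update hφ s
  have hps : ⟪residual φ st s, residual φ st s⟫_ℝ = st.p s := by
    rw [hst.p_eq, real_inner_self_eq_norm_sq]
  refine ⟨?_, ?_, ?_, ?_, ?_, ?_⟩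
  · intro j hj
    rw [hpiv, if_neg (by rintro rfl; omega)]
    exact hst.pivot_none j (by omega)
  · intro j hj k
    obtain ⟨h1, h2⟩ := hnone j hj
    simp [rpnysUpdate, hst.M_row j h1, Matrix.vecMulVec_apply, h2]
  · intro k hk j
    obtain ⟨h1, h2⟩ := hnone k hk
    simp [rpnysUpdate, hst.M_col k h1, Matrix.vecMulVec_apply, h2]
  · intro j l
    rw [slotFeature_update, hst.R_update hφ]
  · intro l j
    rw [slotFeature_update, hres, inner_sub_left, real_inner_smul_left]
    split_ifs with hj
    · rw [hst.inner_residual, hst.inner_residual, hps, div_mul_cancel₀ _ hs.ne',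
        real_inner_comm, sub_self]
    · rw [hst.orth, hst.orth]; simp
  · intro l
    have hIic : ∑ j ∈ Finset.Iic i, rpnysG st i s j * (rpnysUpdate h K st i s).R j l =
        ∑ j, rpnysG st i s j * (rpnysUpdate h K st i s).R j l := by
      refine Finset.sum_subset (Finset.subset_univ _) fun k _ hk => ?_
      rw [Finset.mem_Iic, not_le] at hk
      rw [rpnysG, if_neg hk.not_gt, if_neg hk.ne', zero_mul]
    -- At the pivot the new residual is zero, in agreement with the explicit reset of `p` there;
    -- elsewhere the decrement of `p` is Pythagoras.
    by_cases hl : l = s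
    · subst hl
      rw [hres, hps, div_self hs.ne']
      simp [rpnysUpdate]
    · have : (rpnysUpdate h K st i s).p l = st.p l -
          (∑ j ∈ Finset.Iic i, rpnysG st i s j * (rpnysUpdate h K st i s).R j l) ^ 2 := by
        simp [rpnysUpdate, hl]
      rw [this, hIic, hst.sum_rpnysG_mul hφ, hres, norm_sub_sq_real, real_inner_smul_right,
        norm_smul, mul_pow, ← hst.p_eq, ← hst.p_eq, neg_sq, mul_pow, inv_pow,
        Real.sq_sqrt hs.le, Real.norm_eq_abs, sq_abs,
        real_inner_comm (residual φ st s) (residual φ st l)]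
      field_simp
      ring

end Update

variable [Fintype ι]

theorem RPNysInvariant.of_mem_support_rpnysRound {φ : ι → F} {h : Row d → Row d → ℝ}
    {K : ι → Row d} {st : RPNysState ι r} {i : Fin r} (hst : RPNysInvariant φ i st)
    (hφ : ∀ l l', h (K l) (K l') = ⟪φ l, φ l'⟫_ℝ) {st' : RPNysState ι r}
    (hst' : st' ∈ (rpnysRound h K i st).support) : RPNysInvariant φ (i + 1) st' := by
  unfold rpnysRound at hst'
  split_ifs at hst' with hp
  · rw [PMF.support_pure, Set.mem_singleton_iff] at hst'
    subst hst'
    exact hst.mono (Nat.le_succ _)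
  · rw [PMF.mem_support_map_iff] at hst'
    obtain ⟨s, hs, rfl⟩ := hst'
    rw [PMF.mem_support_normalize_iff, ← pos_iff_ne_zero, ENNReal.ofReal_pos] at hs
    exact hst.update hφ hs

theorem rpnysInvariant_of_mem_support_rpnysRun {φ : ι → F} {h : Row d → Row d → ℝ}
    {K : ι → Row d} (hφ : ∀ l l', h (K l) (K l') = ⟪φ l, φ l'⟫_ℝ) (t : ℕ) :
    ∀ st ∈ (rpnysRun h K r t).support, RPNysInvariant φ t st := by
  induction t with
  | zero =>
    intro st hst
    rw [rpnysRun, PMF.support_pure, Set.mem_singleton_iff] at hst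
    subst hst
    exact rpnysInvariant_init hφ
  | succ t ih =>
    intro st' hst'
    rw [rpnysRun, PMF.mem_support_bind_iff] at hst'
    obtain ⟨st, hst, hst'⟩ := hst'
    split_ifs at hst' with ht
    · exact RPNysInvariant.of_mem_support_rpnysRound (i := ⟨t, ht⟩) (ih st hst) hφ hst'
    · rw [PMF.support_pure, Set.mem_singleton_iff] at hst'
      subst hst'
      exact (ih _ hst).mono (Nat.le_succ _)

end Invariant

/-! ### Expected decrease of the residual in one round -/

section Decrease

open scoped InnerProductSpace

variable {ι : Type} {d r : ℕ} {F : Type} [NormedAddCommGroup F] [InnerProductSpace ℝ F]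
  [Fintype ι] {κ : Type} [Fintype κ]

/-- The coordinate matrix of `b` is orthogonal, and an orthogonal change of basis preserves the
Hilbert–Schmidt norm. -/
theorem sum_norm_sq_orthonormalBasis (b : OrthonormalBasis κ ℝ (EuclideanSpace ℝ ι)) (f : ι → F) :
    ∑ a, ‖∑ l, b a l • f l‖ ^ 2 = ∑ l, ‖f l‖ ^ 2 := by
  classical
  have hb : ∀ l l', ∑ a, b a l * b a l' = if l = l' then 1 else 0 := by
    intro l l'
    have := b.sum_inner_mul_inner (EuclideanSpace.single l (1 : ℝ)) (EuclideanSpace.single l' 1)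
    simpa [EuclideanSpace.inner_single_left, EuclideanSpace.inner_single_right,
      Pi.single_apply, eq_comm] using this
  have h1 : ∀ a, ‖∑ l, b a l • f l‖ ^ 2 = ∑ l, ∑ l', b a l * b a l' * ⟪f l, f l'⟫_ℝ := by
    intro a
    rw [← real_inner_self_eq_norm_sq, sum_inner]
    simp_rw [inner_sum, real_inner_smul_left, real_inner_smul_right, mul_assoc]
  simp_rw [h1]
  rw [Finset.sum_comm]
  refine Finset.sum_congr rfl fun l _ => ?_
  rw [Finset.sum_comm]
  simp_rw [← Finset.sum_mul, hb]
  simp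

/-- The energy of the residuals in the directions `b a`, `a ∈ v`. -/
def residualEnergy (φ : ι → F) (b : OrthonormalBasis κ ℝ (EuclideanSpace ℝ ι)) (v : Finset κ)
    (st : RPNysState ι r) : ℝ :=
  ∑ a ∈ v, ‖∑ l, b a l • residual φ st l‖ ^ 2

variable {φ : ι → F} {b : OrthonormalBasis κ ℝ (EuclideanSpace ℝ ι)} {v : Finset κ}

theorem residualEnergy_nonneg (st : RPNysState ι r) : 0 ≤ residualEnergy φ b v st :=
  Finset.sum_nonneg fun _ _ => by positivity

theorem residualEnergy_add_compl [DecidableEq κ] (st : RPNysState ι r) :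
    residualEnergy φ b v st + residualEnergy φ b vᶜ st = ∑ l, ‖residual φ st l‖ ^ 2 := by
  rw [residualEnergy, residualEnergy, Finset.sum_add_sum_compl, sum_norm_sq_orthonormalBasis]

variable {h : Row d → Row d → ℝ} {K : ι → Row d} {st : RPNysState ι r} {i : Fin r}

/-- Every combination of residuals loses its projection onto the pivot residual, whatever its
coefficients; Pythagoras gives the loss of energy. -/
theorem RPNysInvariant.residualEnergy_update (hst : RPNysInvariant φ i st)
    (hφ : ∀ l l', h (K l) (K l') = ⟪φ l, φ l'⟫_ℝ) (s : ι) :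
    residualEnergy φ b v (rpnysUpdate h K st i s) = residualEnergy φ b v st -
      ∑ a ∈ v, ⟪residual φ st s, ∑ l, b a l • residual φ st l⟫_ℝ ^ 2 / st.p s := by
  rw [residualEnergy, residualEnergy, ← Finset.sum_sub_distrib]
  refine Finset.sum_congr rfl fun a _ => ?_
  have h1 : ∑ l, b a l • residual φ (rpnysUpdate h K st i s) l =
      (∑ l, b a l • residual φ st l) -
        (⟪residual φ st s, ∑ l, b a l • residual φ st l⟫_ℝ / st.p s) • residual φ st s := by
    simp_rw [hst.residual_update hφ, smul_sub, Finset.sum_sub_distrib, inner_sum,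
      real_inner_smul_right, Finset.sum_div, Finset.sum_smul, smul_smul, mul_div_assoc]
  rw [h1]
  set x := ∑ l, b a l • residual φ st l
  rw [norm_sub_sq_real, real_inner_smul_right, norm_smul, mul_pow, ← hst.p_eq, Real.norm_eq_abs,
    sq_abs, real_inner_comm (residual φ st s) x]
  rcases eq_or_ne (st.p s) 0 with hp | hp
  · simp [hp]
  · field_simp
    ring

theorem RPNysInvariant.residualEnergy_update_le (hst : RPNysInvariant φ i st)
    (hφ : ∀ l l', h (K l) (K l') = ⟪φ l, φ l'⟫_ℝ) (s : ι) :
    residualEnergy φ b v (rpnysUpdate h K st i s) ≤ residualEnergy φ b v st := by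
  rw [hst.residualEnergy_update hφ]
  have hp : 0 ≤ st.p s := by rw [hst.p_eq]; positivity
  have : 0 ≤ ∑ a ∈ v, ⟪residual φ st s, ∑ l, b a l • residual φ st l⟫_ℝ ^ 2 / st.p s :=
    Finset.sum_nonneg fun _ _ => by positivity
  linarith

theorem residualEnergy_le_of_mem_support_rpnysRun
    (hφ : ∀ l l', h (K l) (K l') = ⟪φ l, φ l'⟫_ℝ) (t : ℕ) :
    ∀ st ∈ (rpnysRun h K r t).support,
      residualEnergy φ b v st ≤ ∑ a ∈ v, ‖∑ l, b a l • φ l‖ ^ 2 := by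
  induction t with
  | zero =>
    intro st hst
    rw [rpnysRun, PMF.support_pure, Set.mem_singleton_iff] at hst
    subst hst
    simp [residualEnergy, residual_init]
  | succ t ih =>
    intro st' hst'
    rw [rpnysRun, PMF.mem_support_bind_iff] at hst'
    obtain ⟨st, hst, hst'⟩ := hst'
    split_ifs at hst' with ht
    · unfold rpnysRound at hst'
      split_ifs at hst' with hp
      · rw [PMF.support_pure, Set.mem_singleton_iff] at hst'
        exact hst' ▸ ih st hst
      · rw [PMF.mem_support_map_iff] at hst'
        obtain ⟨s, -, rfl⟩ := hst'
        exact (RPNysInvariant.residualEnergy_update_le (i := ⟨t, ht⟩)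
          (rpnysInvariant_of_mem_support_rpnysRun hφ t st hst) hφ s).trans (ih st hst)
    · rw [PMF.support_pure, Set.mem_singleton_iff] at hst'
      exact hst' ▸ ih st hst

/-- For x the combination, ‖x‖² = ∑ b_a(l)⟨f_l, x⟩; apply Cauchy–Schwarz with the unit vector b_a.
-/
theorem norm_pow_four_le_sum_inner_sq (f : ι → F) (a : κ) :
    (‖∑ l, b a l • f l‖ ^ 2) ^ 2 ≤ ∑ s, ⟪f s, ∑ l, b a l • f l⟫_ℝ ^ 2 := by
  set x := ∑ l, b a l • f l with hx
  have h1 : ‖x‖ ^ 2 = ∑ l, b a l * ⟪f l, x⟫_ℝ := by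
    rw [← real_inner_self_eq_norm_sq]
    conv_lhs => rw [hx, sum_inner]
    simp_rw [real_inner_smul_left]
    rfl
  have h2 : ∑ l, b a l ^ 2 = 1 := by
    have := b.norm_eq_one a
    rw [EuclideanSpace.norm_eq, Real.sqrt_eq_one] at this
    simpa using this
  rw [h1]
  simpa [h2] using Finset.sum_mul_sq_le_sq_mul_sq Finset.univ (fun l => b a l)
    (fun l => ⟪f l, x⟫_ℝ)

theorem expectation_rpnysRound_of_ne_zero {f : RPNysState ι r → ℝ} (hf : ∀ st, 0 ≤ f st)
    (hp0 : ∀ s, 0 ≤ st.p s) (hp : ∑ s, st.p s ≠ 0) :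
    expectation (rpnysRound h K i st) (fun st => ENNReal.ofReal (f st)) =
      ENNReal.ofReal (∑ s, st.p s / (∑ l, st.p l) * f (rpnysUpdate h K st i s)) := by
  have hP : 0 < ∑ s, st.p s := lt_of_le_of_ne (Finset.sum_nonneg fun s _ => hp0 s) hp.symm
  have hsum : ∑' l, ENNReal.ofReal (st.p l) = ENNReal.ofReal (∑ l, st.p l) := by
    rw [tsum_fintype, ENNReal.ofReal_sum_of_nonneg fun s _ => hp0 s]
  have hne : ∑' l, ENNReal.ofReal (st.p l) ≠ 0 := by
    rw [hsum]; exact (ENNReal.ofReal_pos.2 hP).ne'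
  rw [rpnysRound, dif_neg hne, expectation_map, expectation, tsum_fintype,
    ENNReal.ofReal_sum_of_nonneg fun s _ => by have := hp0 s; have := hf (rpnysUpdate h K st i s);
                                               positivity]
  refine Finset.sum_congr rfl fun s _ => ?_
  rw [PMF.normalize_apply, hsum, ← ENNReal.ofReal_inv_of_pos hP, ← ENNReal.ofReal_mul (hp0 s),
    ← ENNReal.ofReal_mul (by have := hp0 s; positivity), div_eq_mul_inv]

/-- X − X²/(X+η) = Xη/(X+η) is the minimum over z of z²X + (1−z)²η. Keeping z free gives a bound
affine in X, which can be averaged over a random X. -/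
theorem sub_sq_div_le {X P η k z : ℝ} (hP : 0 < P) (hPX : P ≤ X + η) (hk : 0 < k) :
    X - X ^ 2 / k / P ≤ (1 - 1 / k) * X + 1 / k * (z ^ 2 * X + (1 - z) ^ 2 * η) := by
  have h1 : X - (z ^ 2 * X + (1 - z) ^ 2 * η) ≤ X ^ 2 / P := by
    rw [le_div_iff₀ hP]
    rcases le_or_gt 0 (X - (z ^ 2 * X + (1 - z) ^ 2 * η)) with h | h
    · refine (mul_le_mul_of_nonneg_left hPX h).trans ?_
      nlinarith [sq_nonneg (X * z - (1 - z) * η)]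
    · nlinarith [sq_nonneg X]
  have h2 := mul_le_mul_of_nonneg_left h1 (by positivity : 0 ≤ 1 / k)
  have h3 : X ^ 2 / k / P = 1 / k * (X ^ 2 / P) := by ring
  rw [h3]
  nlinarith

/-- Drawing s with probability p_s/P cancels the 1/p_s in the energy loss. The mean loss is
therefore ∑_a ∑_s ⟨res_s, x_a⟩²/P ≥ ∑_a ‖x_a‖⁴/P ≥ X²/(kP), where x_a is the combination of
residuals with coefficients b_a. -/
theorem RPNysInvariant.expectation_residualEnergy_le {η k z : ℝ} (hst : RPNysInvariant φ i st)
    (hφ : ∀ l l', h (K l) (K l') = ⟪φ l, φ l'⟫_ℝ) (hη : ∑ l, st.p l ≤ residualEnergy φ b v st + η)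
    (hk : 1 ≤ k) (hv : (v.card : ℝ) ≤ k) :
    expectation (rpnysRound h K i st) (fun st => ENNReal.ofReal (residualEnergy φ b v st)) ≤
      ENNReal.ofReal ((1 - 1 / k) * residualEnergy φ b v st +
        1 / k * (z ^ 2 * residualEnergy φ b v st + (1 - z) ^ 2 * η)) := by
  classical
  have hX := residualEnergy_nonneg (φ := φ) (b := b) (v := v) st
  have hp0 : ∀ s, 0 ≤ st.p s := fun s => by rw [hst.p_eq]; positivity
  have hk0 : 0 < k := by linarith
  set X := residualEnergy φ b v st with hXdef
  by_cases hp : ∑ s, st.p s = 0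
  · have h0 : ∑' l, ENNReal.ofReal (st.p l) = 0 := by
      rw [tsum_fintype, ← ENNReal.ofReal_sum_of_nonneg fun s _ => hp0 s, hp, ENNReal.ofReal_zero]
    have hX0 : X ≤ 0 := by
      rw [← hp]
      simp_rw [hst.p_eq]
      rw [← residualEnergy_add_compl (b := b) (v := v)]
      have := residualEnergy_nonneg (φ := φ) (b := b) (v := vᶜ) st
      linarith
    rw [rpnysRound, dif_pos h0, expectation_pure, ← hXdef, ENNReal.ofReal_of_nonpos hX0]
    exact zero_le
  · rw [expectation_rpnysRound_of_ne_zero residualEnergy_nonneg hp0 hp]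
    have hP : 0 < ∑ s, st.p s :=
      lt_of_le_of_ne (Finset.sum_nonneg fun s _ => hp0 s) (Ne.symm hp)
    refine ENNReal.ofReal_le_ofReal ((le_trans ?_) (sub_sq_div_le (z := z) hP hη hk0))
    have h1 : ∀ s, st.p s / (∑ l, st.p l) * residualEnergy φ b v (rpnysUpdate h K st i s) =
        st.p s / (∑ l, st.p l) * X -
          (∑ a ∈ v, ⟪residual φ st s, ∑ l, b a l • residual φ st l⟫_ℝ ^ 2) / ∑ l, st.p l := by
      intro s
      rw [hst.residualEnergy_update hφ, mul_sub, ← hXdef]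
      congr 1
      rw [← Finset.sum_div]
      rcases eq_or_ne (st.p s) 0 with hs | hs
      · have : residual φ st s = 0 := by simpa [hst.p_eq] using hs
        simp [this]
      · field_simp
    simp_rw [h1]
    rw [Finset.sum_sub_distrib, ← Finset.sum_mul, ← Finset.sum_div, div_self hp, one_mul,
      ← Finset.sum_div]
    refine sub_le_sub_left (div_le_div_of_nonneg_right ?_ hP.le) _
    rw [Finset.sum_comm, div_le_iff₀ hk0]
    have h2 : X ^ 2 ≤ v.card * ∑ a ∈ v, (‖∑ l, b a l • residual φ st l‖ ^ 2) ^ 2 :=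
      sq_sum_le_card_mul_sum_sq
    have h3 : ∑ a ∈ v, (‖∑ l, b a l • residual φ st l‖ ^ 2) ^ 2 ≤
        ∑ a ∈ v, ∑ s, ⟪residual φ st s, ∑ l, b a l • residual φ st l⟫_ℝ ^ 2 :=
      Finset.sum_le_sum fun a _ => norm_pow_four_le_sum_inner_sq _ a
    have h4 : 0 ≤ ∑ a ∈ v, (‖∑ l, b a l • residual φ st l‖ ^ 2) ^ 2 :=
      Finset.sum_nonneg fun _ _ => by positivity
    rw [mul_comm]
    nlinarith

/-- The recursion that bounds the expected residual energy. -/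
def decreaseStep (k η x : ℝ) : ℝ :=
  (1 - 1 / k) * x + 1 / k * (x * η / (x + η))

theorem decreaseStep_pos {k η x : ℝ} (hk : 1 ≤ k) (hη : 0 < η) (hx : 0 < x) :
    0 < decreaseStep k η x := by
  have : 1 / k ≤ 1 := by rw [div_le_one (by linarith)]; exact hk
  have h1 : 0 ≤ (1 - 1 / k) * x := mul_nonneg (by linarith) hx.le
  have h2 : 0 < 1 / k * (x * η / (x + η)) := by positivity
  unfold decreaseStep
  linarith

theorem iterate_decreaseStep_pos {k η x : ℝ} (hk : 1 ≤ k) (hη : 0 < η) (hx : 0 < x) (t : ℕ) :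
    0 < (decreaseStep k η)^[t] x := by
  induction t with
  | zero => simpa
  | succ t ih => rw [Function.iterate_succ_apply']; exact decreaseStep_pos hk hη ih

theorem expectation_rpnysRun_residualEnergy_le {η k x : ℝ}
    (hφ : ∀ l l', h (K l) (K l') = ⟪φ l, φ l'⟫_ℝ) [DecidableEq κ]
    (hη : ∑ a ∈ vᶜ, ‖∑ l, b a l • φ l‖ ^ 2 ≤ η) (hη0 : 0 < η) (hk : 1 ≤ k)
    (hv : (v.card : ℝ) ≤ k) (hx : ∑ l, ‖φ l‖ ^ 2 ≤ x) (hx0 : 0 < x) {t : ℕ} (ht : t ≤ r) :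
    expectation (rpnysRun h K r t) (fun st => ENNReal.ofReal (residualEnergy φ b v st)) ≤
      ENNReal.ofReal ((decreaseStep k η)^[t] x) := by
  induction t with
  | zero =>
    rw [rpnysRun, expectation_pure]
    refine ENNReal.ofReal_le_ofReal (le_trans ?_ hx)
    have h1 := residualEnergy_add_compl (φ := φ) (b := b) (v := v)
      (rpnysInit h K : RPNysState ι r)
    have h2 := residualEnergy_nonneg (φ := φ) (b := b) (v := vᶜ)
      (rpnysInit h K : RPNysState ι r)
    simp_rw [residual_init] at h1
    linarith
  | succ t ih =>
    have htr : t < r := ht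
    set y := (decreaseStep k η)^[t] x with hy
    have hy0 : 0 < y := iterate_decreaseStep_pos hk hη0 hx0 t
    -- The minimiser at X = y: the affine bound is then tangent at y to the concave map
    -- `decreaseStep k η`, so averaging under the induction hypothesis returns exactly `decreaseStep
    -- k η y`.
    set z := η / (y + η) with hz
    have hk1 : 1 / k ≤ 1 := by rw [div_le_one (by linarith)]; exact hk
    have hk0 : 0 < 1 / k := by have : 0 < k := by linarith
                               positivity
    have hA : 0 ≤ 1 - 1 / k + 1 / k * z ^ 2 := by
      have : 0 ≤ 1 / k * z ^ 2 := by positivity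
      linarith
    have hB : 0 ≤ 1 / k * ((1 - z) ^ 2 * η) := by positivity
    have hstep : (decreaseStep k η)^[t + 1] x =
        1 / k * ((1 - z) ^ 2 * η) + (1 - 1 / k + 1 / k * z ^ 2) * y := by
      rw [Function.iterate_succ_apply', ← hy, decreaseStep]
      have : y * η / (y + η) = z ^ 2 * y + (1 - z) ^ 2 * η := by
        rw [hz]; field_simp; ring
      rw [this]; ring
    rw [rpnysRun, expectation_bind]
    calc _ ≤ expectation (rpnysRun h K r t) fun st =>
            ENNReal.ofReal (1 / k * ((1 - z) ^ 2 * η)) +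
              ENNReal.ofReal (1 - 1 / k + 1 / k * z ^ 2) *
                ENNReal.ofReal (residualEnergy φ b v st) := by
          refine expectation_mono_of_support fun st hst => ?_
          rw [dif_pos htr]
          have hinv := rpnysInvariant_of_mem_support_rpnysRun hφ t st hst
          have hη' : ∑ l, st.p l ≤ residualEnergy φ b v st + η := by
            simp_rw [hinv.p_eq]
            rw [← residualEnergy_add_compl (b := b) (v := v)]
            have := residualEnergy_le_of_mem_support_rpnysRun (b := b) (v := vᶜ) hφ t st hst
            linarith
          refine (RPNysInvariant.expectation_residualEnergy_le (i := ⟨t, htr⟩) (z := z) hinv hφ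
            hη' hk hv).trans ?_
          rw [← ENNReal.ofReal_mul hA,
            ← ENNReal.ofReal_add hB (mul_nonneg hA (residualEnergy_nonneg st))]
          apply ENNReal.ofReal_le_ofReal
          apply le_of_eq
          ring
      _ = ENNReal.ofReal (1 / k * ((1 - z) ^ 2 * η)) +
            ENNReal.ofReal (1 - 1 / k + 1 / k * z ^ 2) *
              expectation (rpnysRun h K r t) fun st =>
                ENNReal.ofReal (residualEnergy φ b v st) := by
          rw [expectation_add, expectation_const, expectation_const_mul]
      _ ≤ ENNReal.ofReal (1 / k * ((1 - z) ^ 2 * η)) +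
            ENNReal.ofReal (1 - 1 / k + 1 / k * z ^ 2) * ENNReal.ofReal y := by
          gcongr
          exact ih htr.le
      _ = ENNReal.ofReal ((decreaseStep k η)^[t + 1] x) := by
          rw [← ENNReal.ofReal_mul hA, ← ENNReal.ofReal_add hB (mul_nonneg hA hy0.le), hstep]

theorem decreaseStep_le_self {k η x : ℝ} (hk : 1 ≤ k) (hη : 0 < η) (hx : 0 < x) :
    decreaseStep k η x ≤ x := by
  have h1 : x * η / (x + η) ≤ x := by
    rw [div_le_iff₀ (by positivity)]; nlinarith
  have h2 : 0 ≤ 1 / k := by have : 0 < k := by linarith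
                            positivity
  unfold decreaseStep
  nlinarith [mul_le_mul_of_nonneg_left h1 h2]

theorem decreaseStep_one_le {η x : ℝ} (hη : 0 < η) (hx : 0 < x) : decreaseStep 1 η x ≤ η := by
  have h1 : x * η / (x + η) ≤ η := by
    rw [div_le_iff₀ (by positivity)]; nlinarith
  unfold decreaseStep
  simpa using h1

theorem iterate_decreaseStep_one_le {η x : ℝ} (hη : 0 < η) (hx : 0 < x) {t : ℕ} (ht : t ≠ 0) :
    (decreaseStep 1 η)^[t] x ≤ η := by
  obtain ⟨t, rfl⟩ := Nat.exists_eq_succ_of_ne_zero ht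
  rw [Function.iterate_succ_apply']
  exact decreaseStep_one_le hη (iterate_decreaseStep_pos le_rfl hη hx t)

/-- The potential log x − η/x is concave with derivative (x+η)/x², and a step lowers x by
x²/(k(x+η)). The tangent at x thus predicts a loss of exactly 1/k, and concavity makes the true loss
at least that. -/
theorem potential_decreaseStep_le {k η x : ℝ} (hk : 1 ≤ k) (hη : 0 < η) (hx : 0 < x) :
    Real.log (decreaseStep k η x) - η / decreaseStep k η x ≤ Real.log x - η / x - 1 / k := by
  have hf := decreaseStep_pos hk hη hx
  have hle := decreaseStep_le_self hk hη hx
  have hk0 : 0 < k := by linarith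
  set y := decreaseStep k η x with hy
  have hxy : x - y = x ^ 2 / (k * (x + η)) := by
    rw [hy, decreaseStep]; field_simp; ring
  have h1 : Real.log y - Real.log x ≤ y / x - 1 := by
    rw [← Real.log_div hf.ne' hx.ne']
    exact Real.log_le_sub_one_of_pos (by positivity)
  have h2 : η / x - η / y ≤ -(η * (x - y) / x ^ 2) := by
    have : η / x - η / y = -(η * (x - y) / (x * y)) := by field_simp; ring
    rw [this, neg_le_neg_iff]
    apply div_le_div_of_nonneg_left
    · exact mul_nonneg hη.le (by linarith)
    · positivity
    · nlinarith
  have h3 : y / x - 1 - η * (x - y) / x ^ 2 = -(1 / k) := by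
    have : y / x - 1 = -((x - y) / x) := by field_simp; ring
    rw [this, hxy]
    field_simp
    ring
  linarith

theorem iterate_decreaseStep_le {k η x y : ℝ} (hk : 1 ≤ k) (hη : 0 < η) (hx : 0 < x) (hy : 0 < y)
    {t : ℕ} (ht : k * (Real.log x - Real.log y + η / y) ≤ t) :
    (decreaseStep k η)^[t] x ≤ y := by
  have hk0 : 0 < k := by linarith
  have hpot : ∀ t : ℕ, Real.log ((decreaseStep k η)^[t] x) - η / (decreaseStep k η)^[t] x ≤
      Real.log x - η / x - t / k := by
    intro t
    induction t with
    | zero => simp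
    | succ t ih =>
      rw [Function.iterate_succ_apply']
      have := potential_decreaseStep_le hk hη (iterate_decreaseStep_pos hk hη hx t)
      push_cast
      rw [add_div]
      linarith
  by_contra! hcon
  have h1 := Real.log_lt_log hy hcon
  have h2 : η / (decreaseStep k η)^[t] x ≤ η / y :=
    div_le_div_of_nonneg_left hη.le hy hcon.le
  have h3 := hpot t
  have h4 : Real.log x - Real.log y + η / y ≤ t / k := by
    rw [le_div_iff₀ hk0]; linarith
  have h5 : 0 < η / x := by positivity
  linarith

end Decrease

/-! ### A feature map of the exponential kernel -/

section Feature

open scoped InnerProductSpace Nat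

variable {d : ℕ}

/-- The `j`-th tensor power of `x`, in coordinates. -/
def tensorPow (j : ℕ) (x : Row d) : EuclideanSpace ℝ (Fin j → Fin d) :=
  WithLp.toLp 2 fun w => ∏ i, x (w i)

theorem inner_tensorPow (j : ℕ) (x y : Row d) :
    ⟪tensorPow j x, tensorPow j y⟫_ℝ = ⟪x, y⟫_ℝ ^ j := by
  simp only [tensorPow, PiLp.inner_apply, RCLike.inner_apply, conj_trivial]
  rw [Fintype.sum_pow]
  exact Finset.sum_congr rfl fun w _ => Finset.prod_mul_distrib.symm

/-- The feature map of the kernel `exp ⟪x, y⟫` into the Fock space. -/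
def expFeature (x : Row d) : lp (fun j => EuclideanSpace ℝ (Fin j → Fin d)) 2 :=
  ⟨fun j => (√(j ! : ℝ))⁻¹ • tensorPow j x, by
    refine memℓp_gen ?_
    refine (Real.summable_pow_div_factorial (‖x‖ ^ 2)).congr fun j => ?_
    have h : ‖tensorPow j x‖ ^ 2 = (‖x‖ ^ 2) ^ j := by
      rw [← real_inner_self_eq_norm_sq, inner_tensorPow, real_inner_self_eq_norm_sq]
    rw [norm_smul, ENNReal.toReal_ofNat, Real.rpow_ofNat, mul_pow, h, Real.norm_eq_abs, sq_abs,
      inv_pow, Real.sq_sqrt (by positivity), inv_mul_eq_div]⟩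

theorem expFeature_apply (x : Row d) (j : ℕ) :
    expFeature x j = (√(j ! : ℝ))⁻¹ • tensorPow j x := rfl

theorem inner_expFeature (x y : Row d) : ⟪expFeature x, expFeature y⟫_ℝ = Real.exp ⟪x, y⟫_ℝ := by
  have h1 := lp.hasSum_inner (𝕜 := ℝ) (expFeature x) (expFeature y)
  have h2 : HasSum (fun j : ℕ => ⟪x, y⟫_ℝ ^ j / (j ! : ℝ)) (Real.exp ⟪x, y⟫_ℝ) := by
    rw [Real.exp_eq_exp_ℝ]
    exact NormedSpace.expSeries_div_hasSum_exp _
  refine h1.unique (h2.congr_fun ?_)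
  intro j
  rw [expFeature_apply, expFeature_apply, real_inner_smul_left, real_inner_smul_right,
    inner_tensorPow, ← mul_assoc, ← mul_inv, Real.mul_self_sqrt (by positivity), inv_mul_eq_div]

theorem norm_expFeature_sq (x : Row d) : ‖expFeature x‖ ^ 2 = Real.exp (‖x‖ ^ 2) := by
  rw [← real_inner_self_eq_norm_sq, inner_expFeature, real_inner_self_eq_norm_sq]

variable {ι : Type}

/-- The vectors of values at the points `x l` of the monomials of degree at most `s`. -/
def monomialVec (x : ι → Row d) (s : ℕ) (m : Sym (Option (Fin d)) s) : EuclideanSpace ℝ ι :=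
  WithLp.toLp 2 fun l => ((m : Multiset (Option (Fin d))).map fun o => o.elim 1 (x l)).prod

/-- A monomial of degree j is padded with s − j copies of `none`, each standing for the factor 1. -/
theorem exists_monomialVec_eq (x : ι → Row d) {s j : ℕ} (hj : j ≤ s) (w : Fin j → Fin d) :
    ∃ m, ∀ l, monomialVec x s m l = ∏ i, x l (w i) := by
  refine ⟨⟨Finset.univ.val.map (fun i => some (w i)) + Multiset.replicate (s - j) none,
    by simp [hj]⟩, fun l => ?_⟩
  simp [monomialVec, Finset.prod, Function.comp_def]

theorem finrank_span_monomialVec_le (x : ι → Row d) (s : ℕ) :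
    Module.finrank ℝ (Submodule.span ℝ (Set.range (monomialVec x s))) ≤ (s + d).choose s := by
  refine (finrank_range_le_card (monomialVec x s)).trans (le_of_eq ?_)
  rw [Sym.card_sym_eq_choose, Fintype.card_option, Fintype.card_fin]
  congr 1
  omega

variable [Fintype ι]

-- An orthonormal basis of `S` is extended to the whole space; `v` collects the vectors that come
-- from `S`.
open Classical in
theorem exists_orthonormalBasis_adapted (S : Submodule ℝ (EuclideanSpace ℝ ι)) :
    ∃ (κ : Type) (_ : Fintype κ) (b : OrthonormalBasis κ ℝ (EuclideanSpace ℝ ι)) (v : Finset κ),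
      v.card ≤ Module.finrank ℝ S ∧ ∀ a ∉ v, ∀ y ∈ S, ⟪b a, y⟫_ℝ = 0 := by
  set o := stdOrthonormalBasis ℝ S
  have ho : Orthonormal ℝ fun i => (o i : EuclideanSpace ℝ ι) :=
    o.orthonormal.comp_linearIsometry S.subtypeₗᵢ
  obtain ⟨u, b, hu, hb⟩ := ho.toSubtypeRange.exists_orthonormalBasis_extension
  refine ⟨u, inferInstance, b,
    Finset.univ.filter fun a => (a : EuclideanSpace ℝ ι) ∈ Set.range fun i => (o i : EuclideanSpace ℝ ι),
    ?_, ?_⟩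
  · rw [← Finset.card_image_of_injective _ Subtype.val_injective]
    calc _ ≤ (Finset.univ.image fun i => (o i : EuclideanSpace ℝ ι)).card := by
          refine Finset.card_le_card fun y hy => ?_
          simp only [Finset.mem_image, Finset.mem_filter, Finset.mem_univ, true_and] at hy ⊢
          obtain ⟨a, ⟨i, hi⟩, rfl⟩ := hy
          exact ⟨i, hi⟩
      _ ≤ _ := Finset.card_image_le
      _ = _ := by simp
  · intro a ha y hy
    have ha' : ∀ i, ⟪b a, (o i : EuclideanSpace ℝ ι)⟫_ℝ = 0 := by
      intro i
      have hmem : (o i : EuclideanSpace ℝ ι) ∈ u := hu ⟨i, rfl⟩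
      have hbi : b ⟨_, hmem⟩ = (o i : EuclideanSpace ℝ ι) := by rw [hb]
      rw [← hbi]
      apply b.orthonormal.2
      rintro rfl
      simp at ha
    have := o.sum_repr ⟨y, hy⟩
    have hy' : y = ∑ i, o.repr ⟨y, hy⟩ i • (o i : EuclideanSpace ℝ ι) := by
      conv_lhs => rw [← Subtype.coe_mk y hy, ← this]
      simp
    rw [hy', inner_sum]
    simp [real_inner_smul_right, ha']

theorem sum_smul_expFeature_apply (c : ι → ℝ) (x : ι → Row d) (j : ℕ) :
    (∑ l, c l • expFeature (x l)) j = (√(j ! : ℝ))⁻¹ • ∑ l, c l • tensorPow j (x l) := by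
  rw [lp.coeFn_sum, Finset.sum_apply, Finset.smul_sum]
  refine Finset.sum_congr rfl fun l _ => ?_
  rw [lp.coeFn_smul, Pi.smul_apply, expFeature_apply, smul_comm]

theorem hasSum_norm_sum_expFeature (c : ι → ℝ) (x : ι → Row d) :
    HasSum (fun j : ℕ => ‖∑ l, c l • tensorPow j (x l)‖ ^ 2 / (j ! : ℝ))
      (‖∑ l, c l • expFeature (x l)‖ ^ 2) := by
  have h := lp.hasSum_inner (𝕜 := ℝ) (∑ l, c l • expFeature (x l)) (∑ l, c l • expFeature (x l))
  rw [real_inner_self_eq_norm_sq] at h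
  refine h.congr_fun fun j => ?_
  rw [real_inner_self_eq_norm_sq, sum_smul_expFeature_apply, norm_smul, mul_pow,
    Real.norm_eq_abs, sq_abs, inv_pow, Real.sq_sqrt (by positivity), inv_mul_eq_div]

/-- Over the whole basis the sum is the trace of the degree-j part; directions outside `v` only add
to it. -/
theorem sum_norm_tensorPow_sq_le {κ : Type} [Fintype κ]
    (b : OrthonormalBasis κ ℝ (EuclideanSpace ℝ ι)) (v : Finset κ) (x : ι → Row d) (j : ℕ) :
    ∑ a ∈ v, ‖∑ l, b a l • tensorPow j (x l)‖ ^ 2 / (j ! : ℝ) ≤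
      ∑ l, (‖x l‖ ^ 2) ^ j / (j ! : ℝ) := by
  rw [← Finset.sum_div, ← Finset.sum_div]
  refine div_le_div_of_nonneg_right ?_ (by positivity)
  have h : ∀ l, (‖x l‖ ^ 2) ^ j = ‖tensorPow j (x l)‖ ^ 2 := fun l => by
    rw [← real_inner_self_eq_norm_sq (tensorPow j (x l)), inner_tensorPow,
      real_inner_self_eq_norm_sq]
  simp_rw [h]
  rw [← sum_norm_sq_orthonormalBasis b]
  exact Finset.sum_le_sum_of_subset_of_nonneg (Finset.subset_univ _) fun _ _ _ => by positivity

/-- The coordinates of the j-th tensor power are monomials of degree j ≤ s, so coefficients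
orthogonal to these annihilate it. -/
theorem sum_smul_tensorPow_eq_zero {c : EuclideanSpace ℝ ι} {x : ι → Row d} {s j : ℕ}
    (hj : j ≤ s) (hc : ∀ m, ⟪c, monomialVec x s m⟫_ℝ = 0) :
    ∑ l, c l • tensorPow j (x l) = 0 := by
  ext w
  obtain ⟨m, hm⟩ := exists_monomialVec_eq x hj w
  have h0 := hc m
  simp only [PiLp.inner_apply, RCLike.inner_apply, conj_trivial, hm] at h0
  simpa [tensorPow, mul_comm] using h0

omit [Fintype ι] in
theorem le_sum_tsum_nat_add_of_hasSum {f : ℕ → ℝ} {A : ℝ} (hf : HasSum f A) {t : ℕ}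
    (h0 : ∀ j < t, f j = 0) {s : Finset ι} {g : ι → ℕ → ℝ} (hg : ∀ l, Summable (g l))
    (hfg : ∀ j, f j ≤ ∑ l ∈ s, g l j) : A ≤ ∑ l ∈ s, ∑' j, g l (j + t) := by
  have hS : ∀ l, Summable fun j => g l (j + t) := fun l => (summable_nat_add_iff t).2 (hg l)
  rw [← hf.tsum_eq, ← hf.summable.sum_add_tsum_nat_add t,
    Finset.sum_eq_zero fun j hj => h0 j (Finset.mem_range.1 hj), zero_add,
    ← Summable.tsum_finsetSum fun l _ => hS l]
  exact Summable.tsum_le_tsum (fun j => hfg _) ((summable_nat_add_iff t).2 hf.summable)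
    (summable_sum fun l _ => hS l)

theorem sum_norm_sum_expFeature_sq_le {κ : Type} [Fintype κ]
    (b : OrthonormalBasis κ ℝ (EuclideanSpace ℝ ι)) (v : Finset κ) (x : ι → Row d) (s : ℕ)
    (hv : ∀ a ∈ v, ∀ m, ⟪b a, monomialVec x s m⟫_ℝ = 0) :
    ∑ a ∈ v, ‖∑ l, b a l • expFeature (x l)‖ ^ 2 ≤
      ∑ l, ∑' j : ℕ, (‖x l‖ ^ 2) ^ (j + (s + 1)) / ((j + (s + 1))! : ℝ) := by
  have hsum : HasSum (fun j : ℕ => ∑ a ∈ v, ‖∑ l, b a l • tensorPow j (x l)‖ ^ 2 / (j ! : ℝ))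
      (∑ a ∈ v, ‖∑ l, b a l • expFeature (x l)‖ ^ 2) :=
    hasSum_sum fun a _ => hasSum_norm_sum_expFeature _ _
  refine le_sum_tsum_nat_add_of_hasSum hsum (t := s + 1) (fun j hj => ?_)
    (g := fun l j => (‖x l‖ ^ 2) ^ j / (j ! : ℝ))
    (fun l => Real.summable_pow_div_factorial _) (fun j => sum_norm_tensorPow_sq_le b v x j)
  refine Finset.sum_eq_zero fun a ha => ?_
  rw [sum_smul_tensorPow_eq_zero (Nat.lt_succ_iff.1 hj) (hv a ha)]
  simp

open Classical in
theorem exists_orthonormalBasis_tail_le (x : ι → Row d) (s : ℕ) :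
    ∃ (κ : Type) (_ : Fintype κ) (b : OrthonormalBasis κ ℝ (EuclideanSpace ℝ ι)) (v : Finset κ),
      v.card ≤ (s + d).choose s ∧ ∑ a ∈ vᶜ, ‖∑ l, b a l • expFeature (x l)‖ ^ 2 ≤
        ∑ l, ∑' j : ℕ, (‖x l‖ ^ 2) ^ (j + (s + 1)) / ((j + (s + 1))! : ℝ) := by
  obtain ⟨κ, hκ, b, v, hv, hort⟩ :=
    exists_orthonormalBasis_adapted (Submodule.span ℝ (Set.range (monomialVec x s)))
  exact ⟨κ, hκ, b, v, hv.trans (finrank_span_monomialVec_le x s),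
    sum_norm_sum_expFeature_sq_le b vᶜ x s fun a ha m =>
      hort a (Finset.mem_compl.1 ha) _ (Submodule.subset_span ⟨m, rfl⟩)⟩

end Feature

/-! ### The Lambert function -/

section Lambert

theorem lambertW_spec {z : ℝ} (hz : 0 < z) :
    -1 < lambertW z ∧ lambertW z * Real.exp (lambertW z) = z := by
  have h : -Real.exp (-1) < z := by have := Real.exp_pos (-1); linarith
  rw [lambertW, dif_pos h]
  exact (existsUnique_mul_exp h).choose_spec.1

theorem lambertW_pos {z : ℝ} (hz : 0 < z) : 0 < lambertW z := by
  have h := (lambertW_spec hz).2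
  by_contra! hcon
  have := mul_nonpos_of_nonpos_of_nonneg hcon (Real.exp_pos (lambertW z)).le
  linarith

theorem lambertW_mono {z z' : ℝ} (hz : 0 < z) (h : z ≤ z') : lambertW z ≤ lambertW z' := by
  have h1 := (lambertW_spec hz).2
  have h2 := (lambertW_spec (hz.trans_le h)).2
  by_contra! hcon
  have h3 := lambertW_pos (hz.trans_le h)
  have h4 := mul_lt_mul'' hcon (Real.exp_lt_exp.2 hcon) h3.le (Real.exp_pos _).le
  linarith

/-- Of the size of ρ₀ the argument needs only this bound. -/
theorem exp_one_le_rhoZero : Real.exp 1 ≤ rhoZero := by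
  refine Real.le_sqrt_of_sq_le ?_
  have hW : 0 < lambertW (2 / Real.exp 1 ^ 2) := lambertW_pos (by positivity)
  have : Real.exp 1 ^ 2 ≤ Real.exp (lambertW (2 / Real.exp 1 ^ 2) + 2) := by
    have h2 : Real.exp 1 ^ 2 = Real.exp 2 := by rw [← Real.exp_nat_mul]; norm_num
    rw [h2] at hW ⊢
    exact Real.exp_le_exp.2 (by linarith)
  linarith

end Lambert

/-! ### Binomial coefficients and factorials -/

section Stirling

open scoped Nat

theorem factorial_eq_stirlingSeq_mul {n : ℕ} (hn : n ≠ 0) :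
    (n ! : ℝ) = Stirling.stirlingSeq n * (√(2 * n) * (n / Real.exp 1) ^ n) := by
  have : (0 : ℝ) < n := by positivity
  rw [Stirling.stirlingSeq, div_mul_cancel₀]
  positivity

/-- `Stirling.stirlingSeq` is decreasing and stays above √π, so its values at s + d and s compare
and the one at d yields 1/√π. The square-root factors cancel because s + d ≤ 2sd for s, d ≥ 1. -/
theorem choose_mul_pow_le {s d : ℕ} (hs : s ≠ 0) (hd : d ≠ 0) :
    ((s + d).choose s : ℝ) * ((s : ℝ) ^ s * (d : ℝ) ^ d) ≤
      1 / √Real.pi * ((s : ℝ) + d) ^ (s + d) := by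
  have hs0 : (0 : ℝ) < s := by positivity
  have hd0 : (0 : ℝ) < d := by positivity
  have hs1 : (1 : ℝ) ≤ s := by exact_mod_cast Nat.one_le_iff_ne_zero.2 hs
  have hd1 : (1 : ℝ) ≤ d := by exact_mod_cast Nat.one_le_iff_ne_zero.2 hd
  have hpi : 0 < √Real.pi := by have := Real.pi_pos; positivity
  have hCR : ((s + d).choose s : ℝ) * (s ! : ℝ) * (d ! : ℝ) = ((s + d)! : ℝ) := by
    rw [Nat.choose_symm_add]
    exact_mod_cast Nat.add_choose_mul_factorial_mul_factorial s d
  have hanti : Stirling.stirlingSeq (s + d) ≤ Stirling.stirlingSeq s := by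
    have := Stirling.stirlingSeq'_antitone (show s - 1 ≤ s + d - 1 by omega)
    simpa [Nat.succ_eq_add_one, Nat.sub_add_cancel (Nat.one_le_iff_ne_zero.2 hs),
      Nat.sub_add_cancel (show 1 ≤ s + d by omega)] using this
  have hd2 := Stirling.sqrt_pi_le_stirlingSeq hd
  have hs2 : 0 < Stirling.stirlingSeq s := hpi.trans_le (Stirling.sqrt_pi_le_stirlingSeq hs)
  rw [factorial_eq_stirlingSeq_mul hs, factorial_eq_stirlingSeq_mul hd,
    factorial_eq_stirlingSeq_mul (show s + d ≠ 0 by omega)] at hCR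
  have hsq : √(2 * ((s + d : ℕ) : ℝ)) ≤ √(2 * s) * √(2 * d) := by
    rw [← Real.sqrt_mul (by positivity)]
    apply Real.sqrt_le_sqrt
    push_cast
    nlinarith
  set C := ((s + d).choose s : ℝ)
  set a := Stirling.stirlingSeq s
  set b := Stirling.stirlingSeq d
  have h1 : C * ((s : ℝ) ^ s * (d : ℝ) ^ d) * (a * b * (√(2 * s) * √(2 * d))) =
      Stirling.stirlingSeq (s + d) * √(2 * ((s + d : ℕ) : ℝ)) * ((s : ℝ) + d) ^ (s + d) := by
    have he : Real.exp 1 ≠ 0 := (Real.exp_pos 1).ne'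
    rw [div_pow, div_pow, div_pow] at hCR
    have h2 : C * ((s : ℝ) ^ s * (d : ℝ) ^ d) * (a * b * (√(2 * s) * √(2 * d))) =
      C * (a * (√(2 * s) * ((s : ℝ) ^ s / Real.exp 1 ^ s))) *
        (b * (√(2 * d) * ((d : ℝ) ^ d / Real.exp 1 ^ d))) * Real.exp 1 ^ (s + d) := by
      rw [pow_add]
      field_simp
    rw [h2, hCR]
    push_cast
    field_simp
  have h3 : Stirling.stirlingSeq (s + d) * √(2 * ((s + d : ℕ) : ℝ)) * ((s : ℝ) + d) ^ (s + d) ≤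
      1 / √Real.pi * ((s : ℝ) + d) ^ (s + d) * (a * b * (√(2 * s) * √(2 * d))) := by
    have h4 : 1 ≤ 1 / √Real.pi * b := by
      rw [one_div, inv_mul_eq_div, one_le_div hpi]; exact hd2
    calc _ ≤ a * (√(2 * s) * √(2 * d)) * ((s : ℝ) + d) ^ (s + d) := by gcongr
      _ ≤ (1 / √Real.pi * b) * (a * (√(2 * s) * √(2 * d)) * ((s : ℝ) + d) ^ (s + d)) :=
          le_mul_of_one_le_left (by positivity) h4
      _ = _ := by ring
  have hb : 0 < b := hpi.trans_le hd2
  exact le_of_mul_le_mul_right (h1.trans_le h3) (by positivity)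

/-- Gibbs' inequality for two masses. -/
theorem mul_log_sub_le_mul_binEntropy {s d x : ℝ} (hs : 0 < s) (hd : 0 < d) (hsx : s ≤ x) :
    (s + d) * Real.log (s + d) - s * Real.log s - d * Real.log d ≤
      (x + d) * Real.binEntropy (x / (x + d)) := by
  have hx : 0 < x := hs.trans_le hsx
  have hent : (x + d) * Real.binEntropy (x / (x + d)) =
      x * Real.log ((x + d) / x) + d * Real.log ((x + d) / d) := by
    have h1 : 1 - x / (x + d) = d / (x + d) := by field_simp; ring
    rw [Real.binEntropy, h1, inv_div, inv_div]
    field_simp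
  rw [hent]
  -- The bound log t ≥ 1 − 1/t is used at the ratios of the masses (s, d)/(s+d) to (x, d)/(x+d).
  -- Weighted by s and d the right-hand sides cancel; then s ≤ x and log((x+d)/x) ≥ 0 replace s by
  -- x.
  have h1 : Real.log ((x + d) / x * (s / (s + d))) ≥ 1 - ((x + d) / x * (s / (s + d)))⁻¹ :=
    Real.one_sub_inv_le_log_of_pos (by positivity)
  have h2 : Real.log ((x + d) / d * (d / (s + d))) ≥ 1 - ((x + d) / d * (d / (s + d)))⁻¹ :=
    Real.one_sub_inv_le_log_of_pos (by positivity)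
  rw [Real.log_mul (by positivity) (by positivity), Real.log_div (x := s) (by positivity)
    (by positivity)] at h1
  rw [Real.log_mul (by positivity) (by positivity), Real.log_div (x := d) (y := s + d)
    (by positivity) (by positivity)] at h2
  have h3 : s * (1 - ((x + d) / x * (s / (s + d)))⁻¹) +
      d * (1 - ((x + d) / d * (d / (s + d)))⁻¹) = 0 := by
    field_simp
    ring
  have h4 : 0 ≤ Real.log ((x + d) / x) := Real.log_nonneg (by rw [le_div_iff₀ hx]; linarith)
  have h5 := mul_le_mul_of_nonneg_left h1 hs.le
  have h6 := mul_le_mul_of_nonneg_left h2 hd.le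
  have h7 := mul_le_mul_of_nonneg_right hsx h4
  nlinarith

theorem choose_le_exp_binEntropy {s d : ℕ} {x : ℝ} (hs : s ≠ 0) (hd : d ≠ 0) (hsx : s ≤ x) :
    ((s + d).choose s : ℝ) ≤
      1 / √Real.pi * Real.exp ((x + d) * Real.binEntropy (x / (x + d))) := by
  have hs0 : (0 : ℝ) < s := by positivity
  have hd0 : (0 : ℝ) < d := by positivity
  have h1 := choose_mul_pow_le hs hd
  have h2 := Real.exp_le_exp.2 (mul_log_sub_le_mul_binEntropy hs0 hd0 hsx)
  have h3 : Real.exp (((s : ℝ) + d) * Real.log (s + d) - s * Real.log s - d * Real.log d) =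
      ((s : ℝ) + d) ^ (s + d) / ((s : ℝ) ^ s * (d : ℝ) ^ d) := by
    have hp : ∀ (y : ℝ) (k : ℕ), 0 < y → Real.exp (k * Real.log y) = y ^ k := by
      intro y k hy
      rw [Real.exp_nat_mul, Real.exp_log hy]
    rw [Real.exp_sub, Real.exp_sub, hp _ _ hs0, hp _ _ hd0, div_div]
    congr 1
    exact_mod_cast hp ((s : ℝ) + d) (s + d) (by positivity)
  rw [h3] at h2
  refine le_trans ?_ (mul_le_mul_of_nonneg_left h2 (by positivity))
  rw [← mul_div_assoc, le_div_iff₀ (by positivity)]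
  exact h1

/-- Successive terms shrink at least by the factor 1/7, so the tail is at most 7/6 of its first
term; Stirling's √(2πt) ≥ 7/3 makes the constant 1/2. -/
theorem tsum_pow_div_factorial_le {u : ℝ} {t : ℕ} (hu : 0 ≤ u) (ht : t ≠ 0) (hut : 7 * u ≤ t) :
    ∑' j : ℕ, u ^ (j + t) / ((j + t)! : ℝ) ≤ 1 / 2 * (Real.exp 1 * u / t) ^ t := by
  have ht0 : (0 : ℝ) < t := by positivity
  have ht1 : (1 : ℝ) ≤ t := by exact_mod_cast Nat.one_le_iff_ne_zero.2 ht
  have hterm : ∀ j : ℕ, u ^ (j + t) / ((j + t)! : ℝ) ≤ u ^ t / (t ! : ℝ) * (1 / 7) ^ j := by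
    intro j
    have hfac : (t ! : ℝ) * (t : ℝ) ^ j ≤ ((j + t)! : ℝ) := by
      rw [add_comm j t]
      have h : (t ! : ℝ) * ((t : ℝ) + 1) ^ j ≤ ((t + j)! : ℝ) := by
        exact_mod_cast Nat.factorial_mul_pow_le_factorial (m := t) (n := j)
      refine le_trans ?_ h
      gcongr
      linarith
    calc u ^ (j + t) / ((j + t)! : ℝ) ≤ u ^ (j + t) / ((t ! : ℝ) * (t : ℝ) ^ j) := by gcongr
      _ = u ^ t / (t ! : ℝ) * (u / t) ^ j := by rw [div_pow, pow_add]; field_simp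
      _ ≤ _ := by
        refine mul_le_mul_of_nonneg_left (pow_le_pow_left₀ (by positivity) ?_ j) (by positivity)
        rw [div_le_div_iff₀ ht0 (by norm_num)]
        linarith
  have hgeo : HasSum (fun j : ℕ => u ^ t / (t ! : ℝ) * (1 / 7 : ℝ) ^ j)
      (u ^ t / (t ! : ℝ) * (7 / 6)) := by
    refine HasSum.mul_left _ ?_
    have h : (7 / 6 : ℝ) = (1 - 1 / 7)⁻¹ := by norm_num
    rw [h]
    exact hasSum_geometric_of_lt_one (by norm_num) (by norm_num)
  have hsum : Summable fun j : ℕ => u ^ (j + t) / ((j + t)! : ℝ) :=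
    Summable.of_nonneg_of_le (fun j => by positivity) hterm hgeo.summable
  refine (hsum.tsum_le_tsum hterm hgeo.summable).trans ?_
  rw [hgeo.tsum_eq]
  have hst := Stirling.le_factorial_stirling t
  have hsq : (7 / 3 : ℝ) ≤ √(2 * Real.pi * t) := by
    apply Real.le_sqrt_of_sq_le
    have := Real.pi_gt_three
    nlinarith
  have h1 : 7 / 3 * ((t : ℝ) / Real.exp 1) ^ t ≤ (t ! : ℝ) :=
    (mul_le_mul_of_nonneg_right hsq (by positivity)).trans hst
  have h2 : u ^ t / (t ! : ℝ) ≤ u ^ t / (7 / 3 * ((t : ℝ) / Real.exp 1) ^ t) := by gcongr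
  have h3 : u ^ t / (7 / 3 * ((t : ℝ) / Real.exp 1) ^ t) * (7 / 6) =
      1 / 2 * (Real.exp 1 * u / t) ^ t := by
    rw [div_pow, div_pow, mul_pow]
    field_simp
    ring
  rw [← h3]
  gcongr

end Stirling

/-! ### Size of the parameters -/

section Parameters

/-- With `W e^W = (ℓ + 2 g) / (2 ρ g)`, the squared radius `u = 2 W g² / (ℓ + 2 g)` of the scaled
keys is at most `g`, and at most `(α + g) / W * e^{-2 W} / ρ²`. -/
theorem scaled_radius_le {ℓ g α W ρ : ℝ} (hℓ : 0 < ℓ) (hg : 0 < g) (hα : ℓ / 2 ≤ α) (hW : 0 < W)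
    (hρ : 1 ≤ ρ) (hWe : W * Real.exp W = (ℓ + 2 * g) / (2 * ρ * g)) :
    2 * W * g ^ 2 / (ℓ + 2 * g) ≤ g ∧
      2 * W * g ^ 2 / (ℓ + 2 * g) ≤ (α + g) / W * (Real.exp (-2 * W) / ρ ^ 2) := by
  have he := Real.exp_pos W
  have hρ0 : 0 < ρ := by linarith
  have h1 : 2 * W * g / (ℓ + 2 * g) = (ρ * Real.exp W)⁻¹ := by
    have : ℓ + 2 * g = W * Real.exp W * (2 * ρ * g) := by rw [hWe]; field_simp
    rw [this]
    field_simp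
  have hexp : 1 ≤ Real.exp W := Real.one_le_exp hW.le
  constructor
  · have : 2 * W * g ^ 2 / (ℓ + 2 * g) = g * (2 * W * g / (ℓ + 2 * g)) := by ring
    rw [this, h1]
    exact mul_le_of_le_one_right hg.le (inv_le_one_of_one_le₀ (by nlinarith))
  · have h2 : Real.exp (-2 * W) / ρ ^ 2 = (2 * W * g / (ℓ + 2 * g)) ^ 2 := by
      have : -2 * W = -(W + W) := by ring
      rw [h1, this, Real.exp_neg, Real.exp_add]
      field_simp
    rw [h2]
    have h3 : (ℓ + 2 * g) / 2 / W * (2 * W * g / (ℓ + 2 * g)) ^ 2 = 2 * W * g ^ 2 / (ℓ + 2 * g) := by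
      field_simp
    rw [← h3]
    gcongr
    linarith

/-- Since ρ ≥ e and x ≤ t, e·u/t ≤ e^{−2W−1}; raised to the power t ≥ x this gives the exponent
−(2W+1)x = −2(α+g) − x. The first claim uses e² > 7. -/
theorem truncation_error_le {u x α g W ρ : ℝ} {t : ℕ} (hu : 0 ≤ u) (hW : 0 < W) (hx : 0 < x)
    (hxW : x * W = α + g) (hg : 0 ≤ g) (hρ : Real.exp 1 ≤ ρ)
    (hux : u ≤ x * (Real.exp (-2 * W) / ρ ^ 2)) (ht : x ≤ t) :
    7 * u ≤ t ∧ (Real.exp 1 * u / t) ^ t ≤ Real.exp (-(2 * α + x)) := by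
  have ht0 : 0 < (t : ℝ) := hx.trans_le ht
  have hρ2 : Real.exp 2 ≤ ρ ^ 2 := by
    have : Real.exp 2 = Real.exp 1 ^ 2 := by rw [← Real.exp_nat_mul]; norm_num
    rw [this]
    gcongr
  have hu2 : u ≤ t * Real.exp (-2 * W - 2) := by
    rw [Real.exp_sub]
    refine hux.trans ?_
    gcongr
  have he := Real.exp_pos 1
  constructor
  · have h1 : Real.exp (-2 * W - 2) ≤ Real.exp (-2) := Real.exp_le_exp.2 (by linarith)
    have h2 : 7 * Real.exp (-2) ≤ 1 := by
      rw [Real.exp_neg, ← div_eq_mul_inv, div_le_one (Real.exp_pos _)]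
      have : Real.exp 2 = Real.exp 1 ^ 2 := by rw [← Real.exp_nat_mul]; norm_num
      rw [this]
      have := Real.exp_one_gt_d9
      nlinarith
    nlinarith
  · have h1 : Real.exp 1 * u / t ≤ Real.exp (-2 * W - 1) := by
      rw [div_le_iff₀ ht0]
      have : Real.exp (-2 * W - 1) = Real.exp 1 * Real.exp (-2 * W - 2) := by
        rw [← Real.exp_add]; ring_nf
      rw [this]
      nlinarith
    calc (Real.exp 1 * u / t) ^ t ≤ Real.exp (-2 * W - 1) ^ t := by gcongr
      _ = Real.exp (t * (-2 * W - 1)) := by rw [Real.exp_nat_mul]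
      _ ≤ _ := by
        apply Real.exp_le_exp.2
        nlinarith

end Parameters

/-! ### Expected error of `RPNys` for the exponential kernel -/

section RPNysError

open scoped InnerProductSpace

variable {ι : Type} {d r : ℕ}

/-- Total squared error of the weighted coreset `out` in the feature space, for the points
`θ • K l`. -/
def coresetError [Fintype ι] (θ : ℝ) (K : ι → Row d)
    (out : (Fin r → Row d) × Matrix (Fin r) ι ℝ) : ℝ :=
  ∑ l, ‖expFeature (θ • K l) - ∑ j, out.2 j l • expFeature (θ • out.1 j)‖ ^ 2

theorem coresetError_nonneg [Fintype ι] (θ : ℝ) (K : ι → Row d)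
    (out : (Fin r → Row d) × Matrix (Fin r) ι ℝ) : 0 ≤ coresetError θ K out :=
  Finset.sum_nonneg fun _ _ => by positivity

/-- Empty slots are output as the row 0, whose feature vector is not zero; their weights vanish, so
nothing changes. -/
theorem RPNysInvariant.residual_eq {θ : ℝ} {K : ι → Row d} {t : ℕ} {st : RPNysState ι r}
    (hst : RPNysInvariant (fun l => expFeature (θ • K l)) t st) (l : ι) :
    expFeature (θ • K l) - ∑ j, (st.M * st.R) j l • expFeature (θ • (st.pivot j).elim 0 K) =
      residual (fun l => expFeature (θ • K l)) st l := by
  rw [residual]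
  congr 1
  refine Finset.sum_congr rfl fun j _ => ?_
  rcases hj : st.pivot j with _ | s
  · have : (st.M * st.R) j l = 0 := by simp [Matrix.mul_apply, hst.M_row j hj]
    rw [this, zero_smul, zero_smul]
  · simp [slotFeature, hj]

theorem expectation_coresetError_le [Fintype ι] {K : ι → Row d} {h : Row d → Row d → ℝ}
    {θ u c X k : ℝ} {s : ℕ} (hh : ∀ l l', h (K l) (K l') = Real.exp ⟪θ • K l, θ • K l'⟫_ℝ)
    (hu : ∀ l, ‖θ • K l‖ ^ 2 ≤ u) (hc : 0 < c) (hk1 : 1 ≤ k) (hk : ((s + d).choose s : ℝ) ≤ k)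
    (hus : 7 * u ≤ (s + 1 : ℕ))
    (htail : Fintype.card ι * (1 / 2 * (Real.exp 1 * u / (s + 1 : ℕ)) ^ (s + 1)) ≤ c / 2)
    (hX : Fintype.card ι * Real.exp u ≤ X) (hX0 : 0 < X)
    (hr : k = 1 ∧ r ≠ 0 ∨ k * (Real.log X - Real.log (7 / 4 * c) + 2 / 7) ≤ r) :
    expectation (rpnys h K r) (fun out => ENNReal.ofReal (coresetError θ K out)) ≤
      ENNReal.ofReal (9 / 4 * c) := by
  classical
  obtain ⟨κ, hκ, b, v, hv, htl⟩ := exists_orthonormalBasis_tail_le (fun l => θ • K l) s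
  set φ := fun l => expFeature (θ • K l) with hφdef
  have hφ : ∀ l l', h (K l) (K l') = ⟪φ l, φ l'⟫_ℝ := fun l l' => by
    rw [hh, hφdef, inner_expFeature]
  have hη : ∑ a ∈ vᶜ, ‖∑ l, b a l • φ l‖ ^ 2 ≤ c / 2 := by
    refine htl.trans (le_trans ?_ htail)
    rw [← nsmul_eq_mul, ← Finset.card_univ]
    refine Finset.sum_le_card_nsmul _ _ _ fun l _ => ?_
    refine (tsum_pow_div_factorial_le (by positivity) (Nat.succ_ne_zero s)
      (by linarith [hu l])).trans ?_
    have := hu l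
    gcongr
  have hx : ∑ l, ‖φ l‖ ^ 2 ≤ X := by
    refine le_trans ?_ hX
    rw [← nsmul_eq_mul, ← Finset.card_univ]
    refine Finset.sum_le_card_nsmul _ _ _ fun l _ => ?_
    rw [hφdef, norm_expFeature_sq]
    exact Real.exp_le_exp.2 (hu l)
  have hvk : (v.card : ℝ) ≤ k := le_trans (by exact_mod_cast hv) hk
  have hmain := expectation_rpnysRun_residualEnergy_le (r := r) hφ hη (by positivity) hk1 hvk hx
    hX0 le_rfl
  -- Budget: the complement keeps at most η = c/2 and the span is brought down to 7c/4, together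
  -- 9c/4. The quotient of η by 7c/4 is the 2/7 in `hr`.
  have hit : (decreaseStep k (c / 2))^[r] X ≤ 7 / 4 * c := by
    rcases hr with ⟨rfl, hr⟩ | hr
    · have := iterate_decreaseStep_one_le (half_pos hc) hX0 hr
      linarith
    · refine iterate_decreaseStep_le hk1 (by positivity) hX0 (by positivity) ?_
      have : c / 2 / (7 / 4 * c) = 2 / 7 := by field_simp; norm_num
      rw [this]
      exact hr
  rw [rpnys, expectation_map]
  calc _ ≤ expectation (rpnysRun h K r r) fun st =>
          ENNReal.ofReal (residualEnergy φ b v st) + ENNReal.ofReal (c / 2) := by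
        refine expectation_mono_of_support fun st hst => ?_
        have hinv := rpnysInvariant_of_mem_support_rpnysRun hφ r st hst
        rw [← ENNReal.ofReal_add (residualEnergy_nonneg _) (by positivity)]
        apply ENNReal.ofReal_le_ofReal
        have h1 := residualEnergy_le_of_mem_support_rpnysRun (b := b) (v := vᶜ) hφ r st hst
        have h2 : coresetError θ K (fun j => (st.pivot j).elim 0 K, st.M * st.R) =
            ∑ l, ‖residual φ st l‖ ^ 2 :=
          Finset.sum_congr rfl fun l _ => by rw [← hinv.residual_eq]
        rw [h2, ← residualEnergy_add_compl (b := b) (v := v)]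
        linarith
    _ ≤ ENNReal.ofReal (7 / 4 * c) + ENNReal.ofReal (c / 2) := by
        rw [expectation_add, expectation_const]
        gcongr
        exact hmain.trans (ENNReal.ofReal_le_ofReal hit)
    _ = ENNReal.ofReal (9 / 4 * c) := by
        rw [← ENNReal.ofReal_add (by positivity) (by positivity)]
        congr 1
        ring

end RPNysError

/-! ### Expected error of a bin -/

section Bin

open scoped InnerProductSpace

theorem rowNorm_nonneg {ι : Type} {d : ℕ} (X : ι → Row d) : 0 ≤ rowNorm X :=
  Real.iSup_nonneg fun _ => norm_nonneg _

theorem norm_le_rowNorm {ι : Type} [Finite ι] {d : ℕ} (X : ι → Row d) (i : ι) :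
    ‖X i‖ ≤ rowNorm X :=
  le_ciSup (f := fun i => ‖X i‖) (Set.finite_range _).bddAbove i

theorem rowNorm_binKeys_le {n d B : ℕ} (bin : Fin n → Fin B) (K : Fin n → Row d) (b : Fin B) :
    rowNorm (binKeys bin K b) ≤ rowNorm (recenter K) :=
  Real.iSup_le (fun l => norm_le_rowNorm (recenter K) l.1) (rowNorm_nonneg _)

theorem dim_ne_zero_of_rowNorm_pos {ι : Type} {d : ℕ} {X : ι → Row d} (hX : 0 < rowNorm X) :
    d ≠ 0 := by
  rintro rfl
  have : rowNorm X ≤ 0 := Real.iSup_le (fun i => by rw [Subsingleton.elim (X i) 0, norm_zero])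
    le_rfl
  linarith

/-- Up to the factor `log N`, the exponent `σ` of the rank condition for the radius product
`g = β R_Q R_K`, where `ℓ = log N` and `α = a log N`. -/
def rankExponent (ℓ α g : ℝ) : ℝ :=
  (α + g) / lambertW ((ℓ + 2 * g) / (2 * rhoZero * g))

theorem rhoZero_pos : 0 < rhoZero := (Real.exp_pos 1).trans_le exp_one_le_rhoZero

/-- Enlarging g raises the numerator and lowers the Lambert argument. Bins may have a smaller radius
than the whole key set, so the rank condition for the global radius covers them. -/
theorem rankExponent_mono {ℓ α g g' : ℝ} (hℓ : 0 < ℓ) (hα : 0 ≤ α) (hg : 0 < g) (h : g ≤ g') :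
    rankExponent ℓ α g ≤ rankExponent ℓ α g' := by
  have hρ := rhoZero_pos
  have hg' : 0 < g' := hg.trans_le h
  have hz : (ℓ + 2 * g') / (2 * rhoZero * g') ≤ (ℓ + 2 * g) / (2 * rhoZero * g) := by
    rw [div_le_div_iff₀ (by positivity) (by positivity)]
    have : 0 ≤ 2 * rhoZero * ℓ * (g' - g) := mul_nonneg (by positivity) (by linarith)
    nlinarith
  have hz0 : 0 < (ℓ + 2 * g') / (2 * rhoZero * g') := by positivity
  have hW := lambertW_mono hz0 hz
  have hW0 := lambertW_pos hz0
  unfold rankExponent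
  gcongr

theorem exists_expectation_binLaw_le {n d B r : ℕ} {β RQ ℓ α : ℝ} (bin : Fin n → Fin B)
    (K : Fin n → Row d) (b : Fin B) (hd : d ≠ 0) (hβ : 0 < β) (hRQ : 0 < RQ)
    (hℓ : ℓ = Real.log (n / B : ℕ)) (hℓ0 : 0 < ℓ) (hα : ℓ / 2 ≤ α)
    (hcard : 0 < Fintype.card {l // bin l = b}) {G x : ℝ}
    (hG : G = β * RQ * rowNorm (recenter K)) (hx : x = rankExponent ℓ α G) (hG0 : 0 < G)
    (hr : 1 + 1 / √Real.pi * Real.exp ((x + d) * Real.binEntropy (x / (x + d))) *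
      (2 * α + x + 3 * G) ≤ (⌈(r : ℝ) / B⌉₊ : ℝ)) :
    ∃ μ : ℝ, 0 < μ ∧
      expectation (binLaw β RQ r bin K b)
          (fun out => ENNReal.ofReal (coresetError (β / μ) (binKeys bin K b) out)) ≤
        ENNReal.ofReal (9 / 4 * (Fintype.card {l // bin l = b} *
          Real.exp (-(2 * α) - μ ^ 2 * RQ ^ 2))) := by
  have hρ := rhoZero_pos
  have hcard' : (0 : ℝ) < Fintype.card {l // bin l = b} := by exact_mod_cast hcard
  have hWG : 0 < lambertW ((ℓ + 2 * G) / (2 * rhoZero * G)) := lambertW_pos (by positivity)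
  have hx0 : 0 < x := by rw [hx, rankExponent]; have : 0 < α := by linarith
                         positivity
  have hk'0 : 0 ≤ 1 / √Real.pi * Real.exp ((x + d) * Real.binEntropy (x / (x + d))) := by
    positivity
  have hr0 : ⌈(r : ℝ) / B⌉₊ ≠ 0 := by
    intro h0
    rw [h0] at hr
    have : 0 ≤ 1 / √Real.pi * Real.exp ((x + d) * Real.binEntropy (x / (x + d))) *
        (2 * α + x + 3 * G) := mul_nonneg hk'0 (by linarith)
    push_cast at hr
    linarith
  set RK := rowNorm (binKeys bin K b) with hRK
  have hRKle : RK ≤ rowNorm (recenter K) := rowNorm_binKeys_le bin K b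
  rcases (rowNorm_nonneg (binKeys bin K b)).eq_or_lt with h0 | h0
  · rw [← hRK] at h0
    have hzero : ∀ l, binKeys bin K b l = 0 := fun l => by
      have := norm_le_rowNorm (binKeys bin K b) l
      rw [← hRK, ← h0] at this
      exact norm_le_zero_iff.1 this
    -- All keys of the bin are 0, so they share one feature vector and degree 0 captures everything;
    -- any μ would do for the kernel.
    refine ⟨1, one_pos, ?_⟩
    rw [binLaw]
    refine expectation_coresetError_le (u := 0) (s := 0) (k := 1) (c := _)
      (X := Fintype.card {l // bin l = b} * Real.exp 0) ?_ ?_ (by positivity) le_rfl (by simp)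
      (by simp) ?_ le_rfl (by positivity) (Or.inl ⟨rfl, hr0⟩)
    · intro l l'; simp [hzero]
    · intro l; simp [hzero]
    · simp only [mul_zero, zero_div, zero_add, pow_one]
      positivity
  · rw [← hRK] at h0
    set g := β * RQ * RK with hg
    have hg0 : 0 < g := by positivity
    have hgG : g ≤ G := by
      rw [hG, hg]
      exact mul_le_mul_of_nonneg_left hRKle (by positivity)
    set W := lambertW ((ℓ + 2 * g) / (2 * rhoZero * g)) with hW
    have hz : 0 < (ℓ + 2 * g) / (2 * rhoZero * g) := by positivity
    have hW0 : 0 < W := lambertW_pos hz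
    have hWe : W * Real.exp W = (ℓ + 2 * g) / (2 * rhoZero * g) := (lambertW_spec hz).2
    have hbW : lambertW ((ℓ / g + 2) / (2 * rhoZero)) = W := by
      rw [hW]; congr 1; field_simp
    set τ := temperature β RQ RK (n / B) with hτ
    have hτ2 : τ ^ 2 = RK / RQ * ((ℓ / g + 2) / (2 * W)) := by
      rw [hτ, temperature, ← hℓ, ← hg, hbW, Real.sq_sqrt (by positivity)]
    have hτ0 : 0 < τ := by
      rw [hτ, temperature, ← hℓ, ← hg, hbW]
      exact Real.sqrt_pos.2 (by positivity)
    set y := rankExponent ℓ α g with hy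
    have hyx : y ≤ x := by
      rw [hx]; exact rankExponent_mono hℓ0 (by linarith) hg0 hgG
    have hy0 : 0 < y := by rw [hy, rankExponent]; have : 0 < α := by linarith
                           positivity
    have hyW : y * W = α + g := by rw [hy, rankExponent, ← hW]; field_simp
    obtain ⟨hu1, hu2⟩ := scaled_radius_le (α := α) hℓ0 hg0 hα hW0
      ((Real.one_le_exp zero_le_one).trans exp_one_le_rhoZero) hWe
    set u := 2 * W * g ^ 2 / (ℓ + 2 * g) with hu
    have hu0 : 0 ≤ u := by positivity
    have hyy : (α + g) / W = y := by rw [hy, rankExponent, ← hW]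
    rw [hyy] at hu2
    have hμ2 : (√β * τ) ^ 2 * RQ ^ 2 = (ℓ + 2 * g) / (2 * W) := by
      rw [mul_pow, Real.sq_sqrt hβ.le, hτ2]
      have : (ℓ + 2 * g) / (2 * W) = g * ((ℓ / g + 2) / (2 * W)) := by field_simp
      rw [this]
      nth_rewrite 2 [hg]
      field_simp
    -- Here a ≥ 1/2 enters: the factor e^{μ²R_Q²} lost to the query features is at most e^y, which
    -- the truncation error e^{−2α−y} can pay for.
    have hμy : (ℓ + 2 * g) / (2 * W) ≤ y := by
      rw [← hyy, div_le_div_iff₀ (by positivity) hW0]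
      nlinarith
    have hθ : (β / (√β * τ)) ^ 2 = β / τ ^ 2 := by
      rw [div_pow, mul_pow, Real.sq_sqrt hβ.le]
      field_simp
    have hθu : β / τ ^ 2 * RK ^ 2 = u := by
      rw [hτ2, hu]
      have : 2 * W * g ^ 2 / (ℓ + 2 * g) = g * (2 * W / (ℓ / g + 2)) := by field_simp
      rw [this]
      nth_rewrite 2 [hg]
      field_simp
    -- Degrees up to ⌊y⌋ are kept, so the first dropped degree ⌊y⌋ + 1 is at least y.
    obtain ⟨h7, htr⟩ := truncation_error_le (t := ⌊y⌋₊ + 1) hu0 hW0 hy0 hyW hg0.le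
      exp_one_le_rhoZero hu2 (by push_cast; exact (Nat.lt_floor_add_one y).le)
    refine ⟨√β * τ, by positivity, ?_⟩
    rw [binLaw, ← hRK, ← hτ, hμ2]
    refine expectation_coresetError_le (u := u) (s := ⌊y⌋₊) (c := _)
      (k := ((⌊y⌋₊ + d).choose ⌊y⌋₊ : ℝ))
      (X := Fintype.card {l // bin l = b} * Real.exp u) ?_ ?_ (by positivity) ?_ le_rfl
      h7 ?_ le_rfl (by positivity) ?_
    · intro l l'
      rw [real_inner_smul_left, real_inner_smul_right, ← mul_assoc, ← sq, hθ]
      congr 1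
      ring
    · intro l
      rw [norm_smul, mul_pow, Real.norm_eq_abs, sq_abs, hθ, ← hθu]
      have := norm_le_rowNorm (binKeys bin K b) l
      gcongr
    · exact_mod_cast Nat.choose_pos (Nat.le_add_right _ _)
    · have h1 : Real.exp (-(2 * α + y)) ≤ Real.exp (-(2 * α) - (ℓ + 2 * g) / (2 * W)) :=
        Real.exp_le_exp.2 (by linarith)
      have h2 := mul_le_mul_of_nonneg_left (htr.trans h1) hcard'.le
      linarith
    -- In degree 0 the span has dimension at most 1, where the bound with 1/√π < 1 is unavailable.
    -- With k = 1 a single round already brings the energy below η, and the summand 1 in the rank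
    -- condition guarantees that round.
    · by_cases hs : ⌊y⌋₊ = 0
      · left
        exact ⟨by simp [hs], hr0⟩
      · right
        have hk : ((⌊y⌋₊ + d).choose ⌊y⌋₊ : ℝ) ≤ _ :=
          choose_le_exp_binEntropy hs hd ((Nat.floor_le hy0.le).trans hyx)
        have hlog : Real.log (Fintype.card {l // bin l = b} * Real.exp u) -
            Real.log (7 / 4 * (Fintype.card {l // bin l = b} *
              Real.exp (-(2 * α) - (ℓ + 2 * g) / (2 * W)))) + 2 / 7 ≤ 2 * α + x + 3 * G := by
          rw [Real.log_mul hcard'.ne' (Real.exp_pos _).ne', Real.log_exp,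
            Real.log_mul (by norm_num) (by positivity),
            Real.log_mul hcard'.ne' (Real.exp_pos _).ne', Real.log_exp]
          -- log(7/4) ≥ 3/7 absorbs the 2/7.
          have := Real.one_sub_inv_le_log_of_pos (show (0 : ℝ) < 7 / 4 by norm_num)
          norm_num at this
          linarith
        have hL : 0 ≤ 2 * α + x + 3 * G := by linarith
        calc _ ≤ ((⌊y⌋₊ + d).choose ⌊y⌋₊ : ℝ) * (2 * α + x + 3 * G) := by gcongr
          _ ≤ _ * (2 * α + x + 3 * G) := mul_le_mul_of_nonneg_right hk hL
          _ ≤ _ := by linarith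

end Bin

/-! ### Error of weighted attention -/

section Attention

open scoped InnerProductSpace

/-- Perturbation of a weighted mean: clipping to the range of the values makes the error at most
the relative perturbation of the weights times the width of the range. -/
theorem abs_sub_clip_le {ι : Type} [Fintype ι] {A A' v : ι → ℝ} {lo hi : ℝ} (hA : ∀ l, 0 ≤ A l)
    (hS : 0 < ∑ l, A l) (hlo : ∀ l, lo ≤ v l) (hhi : ∀ l, v l ≤ hi) :
    |(∑ l, A l * v l) / (∑ l, A l) -
        max lo (min hi (if 0 < ∑ l, A' l then (∑ l, A' l * v l) / ∑ l, A' l else 0))| ≤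
      (hi - lo) * (∑ l, |A l - A' l|) / ∑ l, A l := by
  set S := ∑ l, A l with hSdef
  set D := ∑ l, A' l with hDdef
  set E := ∑ l, |A l - A' l| with hE
  set O := (∑ l, A l * v l) / S with hO
  have hSO : ∑ l, A l * v l = S * O := by rw [hO]; field_simp
  have hOlo : lo ≤ O := by
    rw [hO, le_div_iff₀ hS, hSdef, Finset.mul_sum]
    exact Finset.sum_le_sum fun l _ => by nlinarith [hA l, hlo l]
  have hOhi : O ≤ hi := by
    rw [hO, div_le_iff₀ hS, hSdef, Finset.mul_sum]
    exact Finset.sum_le_sum fun l _ => by nlinarith [hA l, hhi l]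
  have hlohi : lo ≤ hi := hOlo.trans hOhi
  rw [le_div_iff₀ hS]
  split_ifs with hD
  · set x := (∑ l, A' l * v l) / D with hx
    have hDx : ∑ l, A' l * v l = D * x := by rw [hx]; field_simp
    -- Used with c the clipped value: D(x − c) is then zero or of the sign that only helps, so S·|O
    -- − c| is bounded by the perturbation alone.
    have key : ∀ c, lo ≤ c → c ≤ hi → |S * (O - c) - D * (x - c)| ≤ (hi - lo) * E := by
      intro c hc1 hc2
      have h1 : S * (O - c) - D * (x - c) = ∑ l, (A l - A' l) * (v l - c) := by
        rw [mul_sub, mul_sub, ← hSO, ← hDx, hSdef, hDdef, Finset.sum_mul, Finset.sum_mul,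
          ← Finset.sum_sub_distrib, ← Finset.sum_sub_distrib, ← Finset.sum_sub_distrib]
        exact Finset.sum_congr rfl fun l _ => by ring
      rw [h1, hE, Finset.mul_sum]
      refine (Finset.abs_sum_le_sum_abs _ _).trans (Finset.sum_le_sum fun l _ => ?_)
      rw [abs_mul, mul_comm]
      gcongr
      rw [abs_le]
      constructor <;> linarith [hlo l, hhi l]
    rcases le_total x lo with h1 | h1
    · rw [max_eq_left ((min_le_right _ _).trans h1), abs_of_nonneg (by linarith)]
      have h2 := (abs_le.1 (key lo le_rfl hlohi)).2
      nlinarith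
    · rcases le_total x hi with h2 | h2
      · rw [min_eq_right h2, max_eq_right h1, mul_comm, ← abs_of_pos hS, ← abs_mul]
        have h3 := key x h1 h2
        rwa [sub_self, mul_zero, sub_zero] at h3
      · rw [min_eq_left h2, max_eq_right hlohi, abs_of_nonpos (by linarith)]
        have h3 := (abs_le.1 (key hi hlohi le_rfl)).1
        nlinarith
  -- A nonpositive normaliser forces the perturbation to be at least S, so the trivial bound by the
  -- width of the range suffices.
  · have h1 : S - D ≤ E := by
      rw [hSdef, hDdef, ← Finset.sum_sub_distrib]
      exact Finset.sum_le_sum fun l _ => le_abs_self _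
    have h2 : |O - max lo (min hi 0)| ≤ hi - lo := by
      have h3 : lo ≤ max lo (min hi 0) := le_max_left _ _
      have h4 : max lo (min hi 0) ≤ hi := max_le hlohi (min_le_left _ _)
      rw [abs_le]
      constructor <;> linarith
    calc _ ≤ (hi - lo) * S := by gcongr
      _ ≤ _ := by
        apply mul_le_mul_of_nonneg_left _ (by linarith)
        linarith

variable {m n d B r : ℕ}

theorem maxNorm_nonneg (X : Matrix (Fin m) (Fin d) ℝ) : 0 ≤ maxNorm X :=
  Real.iSup_nonneg fun _ => Real.iSup_nonneg fun _ => abs_nonneg _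

theorem abs_le_maxNorm (X : Matrix (Fin m) (Fin d) ℝ) (i : Fin m) (j : Fin d) :
    |X i j| ≤ maxNorm X :=
  (le_ciSup (f := fun j => |X i j|) (Set.finite_range _).bddAbove j).trans
    (le_ciSup (f := fun i => ⨆ j, |X i j|) (Set.finite_range _).bddAbove i)

theorem maxNorm_le {X : Matrix (Fin m) (Fin d) ℝ} {c : ℝ} (hc : 0 ≤ c) (h : ∀ i j, |X i j| ≤ c) :
    maxNorm X ≤ c :=
  Real.iSup_le (fun i => Real.iSup_le (h i) hc) hc

theorem iSup_sub_iInf_le (hn : 0 < n) (V : Matrix (Fin n) (Fin d) ℝ) (j : Fin d) :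
    (⨆ l, V l j) - (⨅ l, V l j) ≤ 2 * maxNorm V := by
  have : Nonempty (Fin n) := ⟨⟨0, hn⟩⟩
  have h1 : (⨆ l, V l j) ≤ maxNorm V := ciSup_le fun l => (le_abs_self _).trans (abs_le_maxNorm V l j)
  have h2 : -maxNorm V ≤ ⨅ l, V l j := le_ciInf fun l => (abs_le.1 (abs_le_maxNorm V l j)).1
  linarith

/-- The block weight matrix made of the weights of the bins. -/
def blockWeights (bin : Fin n → Fin B)
    (out : ∀ b, (Fin r → Row d) × Matrix (Fin r) {l // bin l = b} ℝ) :
    Matrix (Fin B × Fin r) (Fin n) ℝ :=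
  Matrix.of fun c l => if hl : bin l = c.1 then (out c.1).2 c.2 ⟨l, hl⟩ else 0

/-- The output of `CompressKV` formed from the outputs of the bins. -/
def assemble (K : Fin n → Row d) (V : Matrix (Fin n) (Fin d) ℝ) (bin : Fin n → Fin B)
    (out : ∀ b, (Fin r → Row d) × Matrix (Fin r) {l // bin l = b} ℝ) : Compressed B r d where
  keys := fun c => (out c.1).1 c.2 + rowMean K
  values := blockWeights bin out * V
  weights := fun c => ∑ l, blockWeights bin out c l

theorem wildCat_eq (Q : Fin m → Row d) (K : Fin n → Row d) (V : Matrix (Fin n) (Fin d) ℝ) (β : ℝ)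
    (r : ℕ) (bin : Fin n → Fin B) :
    wildCat Q K V β r bin = (independent (binLaw β (rowNorm Q) r bin K)).map fun out =>
      wtdAttn Q (assemble K V bin out) (fun j => ⨅ l, V l j) (fun j => ⨆ l, V l j) β := by
  rw [wildCat, compressKV, PMF.map_comp]
  rfl

theorem inner_expFeature_smul {β μ : ℝ} (hμ : μ ≠ 0) (x y : Row d) :
    ⟪expFeature (μ • x), expFeature ((β / μ) • y)⟫_ℝ = Real.exp (β * ⟪x, y⟫_ℝ) := by
  rw [inner_expFeature, real_inner_smul_left, real_inner_smul_right, ← mul_assoc,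
    mul_div_cancel₀ _ hμ]

/-- The feature vector of key `l` minus that of its weighted coreset. -/
def binResidual (β : ℝ) (μ : Fin B → ℝ) (bin : Fin n → Fin B) (K : Fin n → Row d)
    (out : ∀ b, (Fin r → Row d) × Matrix (Fin r) {l // bin l = b} ℝ) (b : Fin B)
    (l : {l // bin l = b}) : lp (fun j => EuclideanSpace ℝ (Fin j → Fin d)) 2 :=
  expFeature ((β / μ b) • binKeys bin K b l) -
    ∑ j, (out b).2 j l • expFeature ((β / μ b) • (out b).1 j)

/-- Recentring multiplies exact and approximate weights alike by e^{β⟨q,k̄⟩}; only the bin of l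
contributes to its column. -/
theorem exp_sub_sum_blockWeights (q : Row d) (β : ℝ) {μ : Fin B → ℝ} (hμ : ∀ b, μ b ≠ 0)
    (bin : Fin n → Fin B) (K : Fin n → Row d)
    (out : ∀ b, (Fin r → Row d) × Matrix (Fin r) {l // bin l = b} ℝ) (l : Fin n) :
    Real.exp (β * ⟪q, K l⟫_ℝ) - ∑ c : Fin B × Fin r,
        Real.exp (β * ⟪q, (out c.1).1 c.2 + rowMean K⟫_ℝ) * blockWeights bin out c l =
      Real.exp (β * ⟪q, rowMean K⟫_ℝ) *
        ⟪expFeature (μ (bin l) • q), binResidual β μ bin K out (bin l) ⟨l, rfl⟩⟫_ℝ := by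
  have h1 : ∑ c : Fin B × Fin r,
      Real.exp (β * ⟪q, (out c.1).1 c.2 + rowMean K⟫_ℝ) * blockWeights bin out c l =
      ∑ j, Real.exp (β * ⟪q, (out (bin l)).1 j + rowMean K⟫_ℝ) * (out (bin l)).2 j ⟨l, rfl⟩ := by
    rw [Fintype.sum_prod_type, Finset.sum_eq_single (bin l)]
    · simp [blockWeights]
    · intro b _ hb
      simp [blockWeights, hb.symm]
    · simp
  have h2 : K l = binKeys bin K (bin l) ⟨l, rfl⟩ + rowMean K := by simp [binKeys, recenter]
  rw [h1, binResidual, inner_sub_right, inner_sum, mul_sub, Finset.mul_sum,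
    inner_expFeature_smul (hμ _)]
  conv_lhs => rw [h2]
  congr 1
  · rw [inner_add_right, mul_add, Real.exp_add, mul_comm]
  · refine Finset.sum_congr rfl fun j _ => ?_
    rw [real_inner_smul_right, inner_expFeature_smul (hμ _), inner_add_right, mul_add,
      Real.exp_add]
    ring

/-- Jensen's inequality, by the tangent of exp at the mean; the linear terms sum to zero. -/
theorem card_mul_exp_le_sum (q : Row d) (β : ℝ) (K : Fin n → Row d) :
    n * Real.exp (β * ⟪q, rowMean K⟫_ℝ) ≤ ∑ l, Real.exp (β * ⟪q, K l⟫_ℝ) := by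
  rcases Nat.eq_zero_or_pos n with rfl | hn
  · simp
  have hn0 : (n : ℝ) ≠ 0 := by positivity
  have h1 : ∀ l, Real.exp (β * ⟪q, rowMean K⟫_ℝ) *
      (β * ⟪q, K l⟫_ℝ - β * ⟪q, rowMean K⟫_ℝ + 1) ≤ Real.exp (β * ⟪q, K l⟫_ℝ) := by
    intro l
    have h2 := Real.add_one_le_exp (β * ⟪q, K l⟫_ℝ - β * ⟪q, rowMean K⟫_ℝ)
    have h3 : Real.exp (β * ⟪q, K l⟫_ℝ) = Real.exp (β * ⟪q, rowMean K⟫_ℝ) *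
        Real.exp (β * ⟪q, K l⟫_ℝ - β * ⟪q, rowMean K⟫_ℝ) := by
      rw [← Real.exp_add]; ring_nf
    rw [h3]
    gcongr
  refine le_trans (le_of_eq ?_) (Finset.sum_le_sum fun l _ => h1 l)
  have h4 : ∑ l, ⟪q, K l⟫_ℝ = n * ⟪q, rowMean K⟫_ℝ := by
    rw [rowMean, real_inner_smul_right, inner_sum, mul_inv_cancel_left₀ hn0]
  rw [← Finset.mul_sum, Finset.sum_add_distrib, Finset.sum_sub_distrib, ← Finset.mul_sum, h4]
  simp
  ring

theorem maxNorm_softmaxAttention_sub_le (hn : 0 < n) (Q : Fin m → Row d) (K : Fin n → Row d)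
    (V : Matrix (Fin n) (Fin d) ℝ) (β : ℝ) {μ : Fin B → ℝ} (hμ : ∀ b, 0 < μ b)
    (bin : Fin n → Fin B) (out : ∀ b, (Fin r → Row d) × Matrix (Fin r) {l // bin l = b} ℝ) :
    maxNorm (softmaxAttention β Q K V -
        wtdAttn Q (assemble K V bin out) (fun j => ⨅ l, V l j) (fun j => ⨆ l, V l j) β) ≤
      2 * maxNorm V * ((n : ℝ)⁻¹ * ∑ b, ∑ l,
        Real.exp (μ b ^ 2 * rowNorm Q ^ 2 / 2) * ‖binResidual β μ bin K out b l‖) := by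
  have hn0 : (0 : ℝ) < n := by exact_mod_cast hn
  have hV := maxNorm_nonneg V
  set T := ∑ b, ∑ l, Real.exp (μ b ^ 2 * rowNorm Q ^ 2 / 2) * ‖binResidual β μ bin K out b l‖
    with hT
  have hT0 : 0 ≤ T := Finset.sum_nonneg fun _ _ => Finset.sum_nonneg fun _ _ => by positivity
  refine maxNorm_le (by positivity) fun i j => ?_
  set A : Fin n → ℝ := fun l => Real.exp (β * ⟪Q i, K l⟫_ℝ) with hA
  set A' : Fin n → ℝ := fun l => ∑ c : Fin B × Fin r,
    Real.exp (β * ⟪Q i, (out c.1).1 c.2 + rowMean K⟫_ℝ) * blockWeights bin out c l with hA'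
  set e := Real.exp (β * ⟪Q i, rowMean K⟫_ℝ) with he
  have he0 : 0 < e := Real.exp_pos _
  have hS : n * e ≤ ∑ l, A l := card_mul_exp_le_sum (Q i) β K
  have hS0 : 0 < ∑ l, A l := lt_of_lt_of_le (by positivity) hS
  have hE : ∑ l, |A l - A' l| ≤ e * T := by
    have h1 : ∀ l, |A l - A' l| ≤ e * (Real.exp (μ (bin l) ^ 2 * rowNorm Q ^ 2 / 2) *
        ‖binResidual β μ bin K out (bin l) ⟨l, rfl⟩‖) := by
      intro l
      rw [hA, hA']
      simp only
      rw [exp_sub_sum_blockWeights (Q i) β (fun b => (hμ b).ne') bin K out l, abs_mul,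
        abs_of_pos he0]
      refine mul_le_mul_of_nonneg_left ((abs_real_inner_le_norm _ _).trans ?_) he0.le
      gcongr
      rw [← abs_of_nonneg (norm_nonneg (expFeature _)), ← abs_of_pos (Real.exp_pos _), ← sq_le_sq,
        norm_expFeature_sq, ← Real.exp_nat_mul]
      apply Real.exp_le_exp.2
      have h2 := norm_le_rowNorm Q i
      rw [norm_smul, mul_pow, Real.norm_eq_abs, sq_abs]
      push_cast
      have h3 : ‖Q i‖ ^ 2 ≤ rowNorm Q ^ 2 := by gcongr
      nlinarith [mul_le_mul_of_nonneg_left h3 (sq_nonneg (μ (bin l)))]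
    refine (Finset.sum_le_sum fun l _ => h1 l).trans (le_of_eq ?_)
    rw [← Finset.mul_sum, hT, ← Fintype.sum_fiberwise bin]
    congr 1
    refine Finset.sum_congr rfl fun b _ => Finset.sum_congr rfl fun l _ => ?_
    obtain ⟨l, rfl⟩ := l
    rfl
  have hnorm : (Matrix.of fun i (c : Fin B × Fin r) =>
      Real.exp (β * ⟪Q i, (assemble K V bin out).keys c⟫_ℝ)).mulVec
        (assemble K V bin out).weights i = ∑ l, A' l := by
    simp only [Matrix.mulVec, dotProduct, assemble, Matrix.of_apply, hA', Finset.mul_sum]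
    exact Finset.sum_comm
  have hval : ((Matrix.of fun i (c : Fin B × Fin r) =>
      Real.exp (β * ⟪Q i, (assemble K V bin out).keys c⟫_ℝ)) *
        (assemble K V bin out).values) i j = ∑ l, A' l * V l j := by
    simp only [assemble]
    rw [← Matrix.mul_assoc, Matrix.mul_apply]
    rfl
  have hclip := abs_sub_clip_le (A' := A') (v := fun l => V l j) (lo := ⨅ l, V l j)
    (hi := ⨆ l, V l j) (fun l => (Real.exp_pos _).le) hS0
    (fun l => ciInf_le (Set.finite_range _).bddBelow l)
    (fun l => le_ciSup (f := fun l => V l j) (Set.finite_range _).bddAbove l)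
  have hgoal : (softmaxAttention β Q K V -
      wtdAttn Q (assemble K V bin out) (fun j => ⨅ l, V l j) (fun j => ⨆ l, V l j) β) i j =
      (∑ l, A l * V l j) / (∑ l, A l) - max (⨅ l, V l j) (min (⨆ l, V l j)
        (if 0 < ∑ l, A' l then (∑ l, A' l * V l j) / ∑ l, A' l else 0)) := by
    rw [← hnorm, ← hval]
    rfl
  rw [hgoal]
  refine hclip.trans ?_
  rw [div_le_iff₀ hS0]
  have hE0 : 0 ≤ ∑ l, |A l - A' l| := Finset.sum_nonneg fun _ _ => abs_nonneg _
  calc _ ≤ 2 * maxNorm V * (e * T) :=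
        mul_le_mul (iSup_sub_iInf_le hn V j) hE hE0 (by positivity)
    _ = 2 * maxNorm V * ((n : ℝ)⁻¹ * T) * (n * e) := by field_simp
    _ ≤ _ := by gcongr

end Attention

/-! ### Expected error of `WildCat` -/

section Main

variable {m n d B : ℕ}

theorem expectation_wildCat_le {r : ℕ} (hn : 0 < n) (Q : Fin m → Row d) (K : Fin n → Row d)
    (V : Matrix (Fin n) (Fin d) ℝ) (β α : ℝ) (bin : Fin n → Fin B)
    (h : ∀ b, ∃ μ : ℝ, 0 < μ ∧
      expectation (binLaw β (rowNorm Q) r bin K b)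
          (fun out => ENNReal.ofReal (coresetError (β / μ) (binKeys bin K b) out)) ≤
        ENNReal.ofReal (9 / 4 * (Fintype.card {l // bin l = b} *
          Real.exp (-(2 * α) - μ ^ 2 * rowNorm Q ^ 2)))) :
    expectation (wildCat Q K V β r bin)
        (fun O => ENNReal.ofReal (maxNorm (softmaxAttention β Q K V - O))) ≤
      ENNReal.ofReal (3 * maxNorm V * Real.exp (-α)) := by
  choose μ hμ hexp using h
  have hn0 : (0 : ℝ) < n := by exact_mod_cast hn
  have hV := maxNorm_nonneg V
  -- With y = e^{μ²R_Q²/2} and z a residual norm, yz ≤ (e^α/3)(yz)² + (3/4)e^{−α}, with equality at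
  -- yz = (3/2)e^{−α}. The weight is the coefficient of z²; the expected quadratic part is again at
  -- most (3/4)e^{−α} per key, and 2‖V‖ · (3/2)e^{−α} gives the constant 3.
  set w : Fin B → ℝ := fun b => Real.exp (μ b ^ 2 * rowNorm Q ^ 2) * Real.exp α / 3 with hw
  have hw0 : ∀ b, 0 ≤ w b := fun b => by rw [hw]; positivity
  have hcardsum : ∑ b, (Fintype.card {l // bin l = b} : ℝ) = n := by
    rw [← Nat.cast_sum, ← Fintype.card_sigma, Fintype.card_congr (Equiv.sigmaFiberEquiv bin),
      Fintype.card_fin]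
  have hpt : ∀ out : ∀ b, (Fin ⌈(r : ℝ) / B⌉₊ → Row d) ×
      Matrix (Fin ⌈(r : ℝ) / B⌉₊) {l // bin l = b} ℝ,
      ∑ b, ∑ l, Real.exp (μ b ^ 2 * rowNorm Q ^ 2 / 2) * ‖binResidual β μ bin K out b l‖ ≤
        (∑ b, w b * coresetError (β / μ b) (binKeys bin K b) (out b)) +
          n * (3 / 4 * Real.exp (-α)) := by
    intro out
    rw [← hcardsum, Finset.sum_mul, ← Finset.sum_add_distrib]
    refine Finset.sum_le_sum fun b _ => ?_
    rw [coresetError, Finset.mul_sum, ← nsmul_eq_mul, ← Finset.card_univ, ← Finset.sum_const,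
      ← Finset.sum_add_distrib]
    refine Finset.sum_le_sum fun l _ => ?_
    change Real.exp (μ b ^ 2 * rowNorm Q ^ 2 / 2) * ‖binResidual β μ bin K out b l‖ ≤
      w b * ‖binResidual β μ bin K out b l‖ ^ 2 + 3 / 4 * Real.exp (-α)
    set z := ‖binResidual β μ bin K out b l‖
    have h1 : Real.exp (μ b ^ 2 * rowNorm Q ^ 2) = Real.exp (μ b ^ 2 * rowNorm Q ^ 2 / 2) ^ 2 := by
      rw [← Real.exp_nat_mul]; push_cast; ring_nf
    have h2 : Real.exp (-α) * Real.exp α = 1 := by rw [← Real.exp_add]; simp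
    rw [hw]
    simp only [h1]
    set y := Real.exp (μ b ^ 2 * rowNorm Q ^ 2 / 2)
    have h3 : y ^ 2 * Real.exp α / 3 * z ^ 2 + 3 / 4 * Real.exp (-α) - y * z =
        Real.exp α / 3 * (y * z - 3 / 2 * Real.exp (-α)) ^ 2 := by
      have : Real.exp α / 3 * (y * z - 3 / 2 * Real.exp (-α)) ^ 2 =
        y ^ 2 * Real.exp α / 3 * z ^ 2 - (Real.exp (-α) * Real.exp α) * (y * z) +
          3 / 4 * Real.exp (-α) * (Real.exp (-α) * Real.exp α) := by ring
      rw [this, h2]; ring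
    have h4 : 0 ≤ Real.exp α / 3 * (y * z - 3 / 2 * Real.exp (-α)) ^ 2 := by positivity
    linarith
  set C := 2 * maxNorm V * (n : ℝ)⁻¹ with hC
  have hC0 : 0 ≤ C := by positivity
  have hce : ∀ b, ∀ o : (Fin ⌈(r : ℝ) / B⌉₊ → Row d) ×
      Matrix (Fin ⌈(r : ℝ) / B⌉₊) {l // bin l = b} ℝ,
      0 ≤ w b * coresetError (β / μ b) (binKeys bin K b) o :=
    fun b o => mul_nonneg (hw0 b) (coresetError_nonneg _ _ _)
  rw [wildCat_eq, expectation_map]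
  calc _ ≤ expectation (independent (binLaw β (rowNorm Q) r bin K)) fun out =>
          ENNReal.ofReal C * ((∑ b, ENNReal.ofReal (w b) *
            ENNReal.ofReal (coresetError (β / μ b) (binKeys bin K b) (out b))) +
              ENNReal.ofReal (n * (3 / 4 * Real.exp (-α)))) := by
        refine expectation_mono fun out => ?_
        simp_rw [← ENNReal.ofReal_mul (hw0 _)]
        rw [← ENNReal.ofReal_sum_of_nonneg fun b _ => hce b (out b),
          ← ENNReal.ofReal_add (Finset.sum_nonneg fun b _ => hce b (out b)) (by positivity),
          ← ENNReal.ofReal_mul hC0]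
        apply ENNReal.ofReal_le_ofReal
        refine (maxNorm_softmaxAttention_sub_le hn Q K V β hμ bin out).trans ?_
        rw [← mul_assoc, ← hC]
        exact mul_le_mul_of_nonneg_left (hpt out) hC0
    _ = ENNReal.ofReal C * ((∑ b, ENNReal.ofReal (w b) *
          expectation (binLaw β (rowNorm Q) r bin K b) (fun o =>
            ENNReal.ofReal (coresetError (β / μ b) (binKeys bin K b) o))) +
              ENNReal.ofReal (n * (3 / 4 * Real.exp (-α)))) := by
        rw [expectation_const_mul, expectation_add, expectation_const,
          expectation_independent_sum _ fun b o => ENNReal.ofReal (w b) *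
            ENNReal.ofReal (coresetError (β / μ b) (binKeys bin K b) o)]
        simp_rw [expectation_const_mul]
    _ ≤ ENNReal.ofReal C * ((∑ b, ENNReal.ofReal (w b) *
          ENNReal.ofReal (9 / 4 * (Fintype.card {l // bin l = b} *
            Real.exp (-(2 * α) - μ b ^ 2 * rowNorm Q ^ 2)))) +
              ENNReal.ofReal (n * (3 / 4 * Real.exp (-α)))) := by
        gcongr with b
        exact hexp b
    _ = ENNReal.ofReal (3 * maxNorm V * Real.exp (-α)) := by
        simp_rw [← ENNReal.ofReal_mul (hw0 _)]
        rw [← ENNReal.ofReal_sum_of_nonneg fun b _ => mul_nonneg (hw0 b) (by positivity),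
          ← ENNReal.ofReal_add
            (Finset.sum_nonneg fun b _ => mul_nonneg (hw0 b) (by positivity)) (by positivity),
          ← ENNReal.ofReal_mul hC0]
        congr 1
        have h1 : ∀ b, w b * (9 / 4 * (Fintype.card {l // bin l = b} *
            Real.exp (-(2 * α) - μ b ^ 2 * rowNorm Q ^ 2))) =
            Fintype.card {l // bin l = b} * (3 / 4 * Real.exp (-α)) := by
          intro b
          have h2 : Real.exp (μ b ^ 2 * rowNorm Q ^ 2) * Real.exp α *
              Real.exp (-(2 * α) - μ b ^ 2 * rowNorm Q ^ 2) = Real.exp (-α) := by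
            rw [← Real.exp_add, ← Real.exp_add]; ring_nf
          rw [← h2, hw]
          ring
        simp_rw [h1]
        rw [← Finset.sum_mul, hcardsum, hC]
        field_simp
        ring

end Main

end WildCat

end

theorem mainTheorem1 {m n d B : ℕ}
    (Q : Fin m → WildCat.Row d) (K : Fin n → WildCat.Row d) (V : Matrix (Fin n) (Fin d) ℝ)
    (β a : ℝ) (r : ℕ) (bin : Fin n → Fin B)
    (hβ : 0 < β) (ha : 1 / 2 ≤ a)
    (hbin : WildCat.IsEvenBinning bin) (hn : 2 ≤ n / B)
    (hQ : 0 < WildCat.rowNorm Q) (hK : 0 < WildCat.rowNorm (WildCat.recenter K))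
    (N γ δ σ : ℝ)
    (hN : N = ((n / B : ℕ) : ℝ))
    (hγ : γ = β * WildCat.rowNorm Q * WildCat.rowNorm (WildCat.recenter K) / Real.log N)
    (hδ : δ = d / Real.log N)
    (hσ : σ = (a + γ) /
      WildCat.lambertW (1 / (2 * WildCat.rhoZero * γ) + 1 / WildCat.rhoZero))
    (hr : 1 + 1 / √Real.pi * N ^ ((σ + δ) * Real.binEntropy (σ / (σ + δ))) *
      Real.log (N ^ (2 * a + σ + 3 * γ)) ≤ (⌈(r : ℝ) / B⌉₊ : ℝ)) :
    WildCat.expectation (WildCat.wildCat Q K V β r bin)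
        (fun O => ENNReal.ofReal
          (WildCat.maxNorm (WildCat.softmaxAttention β Q K V - O))) ≤
      ENNReal.ofReal (3 * WildCat.maxNorm V * N ^ (-a)) := by
  have hN2 : 2 ≤ N := by rw [hN]; exact_mod_cast hn
  have hN0 : 0 < N := by linarith
  set ℓ := Real.log N with hℓ
  have hℓ0 : 0 < ℓ := Real.log_pos (by linarith)
  set G := β * WildCat.rowNorm Q * WildCat.rowNorm (WildCat.recenter K) with hG
  have hG0 : 0 < G := by positivity
  have hρ := WildCat.rhoZero_pos
  have hγG : γ * ℓ = G := by rw [hγ]; field_simp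
  have hδd : δ * ℓ = d := by rw [hδ]; field_simp
  -- Multiplication by log N turns the normalised parameters γ, δ, σ into G, d and the exponent x
  -- used for the bins.
  have hx : σ * ℓ = WildCat.rankExponent ℓ (a * ℓ) G := by
    have h1 : (ℓ + 2 * G) / (2 * WildCat.rhoZero * G) =
        1 / (2 * WildCat.rhoZero * γ) + 1 / WildCat.rhoZero := by
      rw [hγ]; field_simp
    rw [WildCat.rankExponent, h1, hσ, ← hγG]
    ring
  have hn0 : 0 < n := by
    rcases Nat.eq_zero_or_pos n with rfl | h
    · simp at hn
    · exact h
  have hpow : N ^ (-a) = Real.exp (-(a * ℓ)) := by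
    rw [Real.rpow_def_of_pos hN0, ← hℓ]; ring_nf
  have hr' : 1 + 1 / √Real.pi *
      Real.exp ((σ * ℓ + d) * Real.binEntropy (σ * ℓ / (σ * ℓ + d))) *
        (2 * (a * ℓ) + σ * ℓ + 3 * G) ≤ (⌈(r : ℝ) / B⌉₊ : ℝ) := by
    rw [← hδd, ← hγG, ← add_mul, mul_div_mul_right _ _ hℓ0.ne']
    rw [Real.log_rpow hN0, Real.rpow_def_of_pos hN0, ← hℓ] at hr
    refine le_trans (le_of_eq ?_) hr
    ring_nf
  rw [hpow]
  refine WildCat.expectation_wildCat_le hn0 Q K V β (a * ℓ) bin fun b => ?_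
  refine WildCat.exists_expectation_binLaw_le bin K b (WildCat.dim_ne_zero_of_rowNorm_pos hQ) hβ
    hQ (by rw [hℓ, hN]) hℓ0 (by nlinarith) ?_ hG hx hG0 hr'
  have := (hbin b).1
  rw [Nat.card_eq_fintype_card] at this
  omega
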